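/- Consider the terms $t,u ::= x \mid \lambda x.t \mid t\,u \mid t[\_/u]$, taken modulo $\alpha$-conversion, where $\lambda$ is the only binder; the \emph{void jump} $[\_/u]$ binds nothing, and $\mathrm{fv}(t[\_/u])=\mathrm{fv}(t)\cup\mathrm{fv}(u)$. The $\lambda$-terms are the terms without jumps, and $\to_\beta$ on them is the contextual closure of $(\lambda x.t)\,u\mapsto t\{x/u\}$. Contexts are $C ::= \Box \mid \lambda y.C \mid C\,v \mid v\,C \mid C[\_/v] \mid v[\_/C]$, and boxed contexts are $B ::= t\,C \mid t[\_/C] \mid B\,t \mid B[\_/t] \mid \lambda y.B$. Let $\to_{\lambda\mathsf{void}}$ be the closure under contexts of the following rules, in which $\mathtt L$ is a possibly empty list of void jumps: - $(\beta)$ $(\lambda x.t)\,\mathtt L\;u\mapsto t\{x/u\}\,\mathtt L$ if $x\in\mathrm{fv}(t)$; - $(\mathtt{dB})$ $(\lambda x.t)\,\mathtt L\;u\mapsto t[\_/u]\,\mathtt L$ if $x\notin\mathrm{fv}(t)$; - $(\mathtt h)$ $t[\_/u]\mapsto t[\_/u_1]\cdots[\_/u_n]$ for any $n\ge 0$, if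 each $u_i$ is a strict subterm of $u$ none of whose free variables is bound in $u$ (so that $\mathrm{fv}(u_i)\subseteq\mathrm{fv}(u)$); - $(\mathtt u)$ $B\langle t[\_/u]\rangle\mapsto B\langle t\rangle[\_/u]$ if $B$ is a boxed context that does not bind any free variable of $u$. Let $\equiv_{\mathtt o}$ be the least equivalence relation closed under contexts that contains $t[\_/s][\_/v]\sim t[\_/v][\_/s]$, $\ \lambda y.(t[\_/s])\sim(\lambda y.t)[\_/s]$ if $y\notin\mathrm{fv}(s)$, and $t[\_/s]\,v\sim(t\,v)[\_/s]$. Let $t\to_{\lambda\mathsf{void}/\mathtt o}t'$ iff $t\equiv_{\mathtt o}t_1\to_{\lambda\mathsf{void}}t_1'\equiv_{\mathtt o}t'$ for some $t_1,t_1'$. A term is in $\mathcal{SN}_{R}$ if no infinite $R$-reduction sequence starts from it. For a set of variables $\Gamma$, the trunk of a term is defined by $\mathrm{tr}_\Gamma(x)=x$, $\ \mathrm{tr}_\Gamma(t\,u)=\mathrm{tr}_\Gamma(t)\,u$, $\ \mathrm{tr}_\Gamma(\lambda x.t)=\lambda x.\mathrm{tr}_{\Gamma\cup\{x\}}(t)$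 (with $x$ fresh for $\Gamma$), and $\mathrm{tr}_\Gamma(t[\_/u])=\mathrm{tr}_\Gamma(t)$ if $\mathrm{fv}(u)\cap\Gamma=\emptyset$, $\ \mathrm{tr}_\Gamma(t[\_/u])=\mathrm{tr}_\Gamma(t)[\_/u]$ otherwise. The surface jumps of $t$ are the jumps $[\_/u]$ that are removed in computing $\mathrm{tr}_\emptyset(t)$. Then: 1. (VIE) For every term $t$, if $\mathrm{tr}_\emptyset(t)\in\mathcal{SN}_{\lambda\mathsf{void}/\mathtt o}$ and $u\in\mathcal{SN}_{\lambda\mathsf{void}/\mathtt o}$ for every surface jump $[\_/u]$ of $t$, then $t\in\mathcal{SN}_{\lambda\mathsf{void}/\mathtt o}$. 2. (PSN) For every $\lambda$-term $t$, if $t\in\mathcal{SN}_\beta$, then $t\in\mathcal{SN}_{\lambda\mathsf{void}/\mathtt o}$. -/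

import Mathlib

namespace VoidJumps

/-- Terms `t, u ::= x | λx.t | t u | t[_/u]` with void jumps only, up to `α`-conversion
(de Bruijn indices: `lam` is the only binder, a void jump binds nothing). -/
inductive VTerm : Type
  | var : ℕ → VTerm
  | lam : VTerm → VTerm
  | app : VTerm → VTerm → VTerm
  | jump : VTerm → VTerm → VTerm

namespace VTerm

/-- The `λ`-terms are the terms without jumps. -/
def IsLambda : VTerm → Prop
  | var _ => True
  | lam t => IsLambda t
  | app t u => IsLambda t ∧ IsLambda u
  | jump _ _ => False

/-- The set of free variables. -/
def fv : VTerm → Set ℕ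
  | var n => {n}
  | lam t => {n | n + 1 ∈ fv t}
  | app t u => fv t ∪ fv u
  | jump t u => fv t ∪ fv u

/-- Extension of a renaming to the scope of one more binder. -/
def liftRen (ξ : ℕ → ℕ) : ℕ → ℕ
  | 0 => 0
  | n + 1 => ξ n + 1

/-- Capture-avoiding renaming of the free variables. -/
def rename : (ℕ → ℕ) → VTerm → VTerm
  | ξ, var n => var (ξ n)
  | ξ, lam t => lam (rename (liftRen ξ) t)
  | ξ, app t u => app (rename ξ t) (rename ξ u)
  | ξ, jump t u => jump (rename ξ t) (rename ξ u)

/-- The same term, seen in the scope of `k` more binders, none of which it uses. -/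
def shift (k : ℕ) (t : VTerm) : VTerm := rename (fun n => n + k) t

/-- Extension of a simultaneous substitution to the scope of one more binder. -/
def liftSubst (σ : ℕ → VTerm) : ℕ → VTerm
  | 0 => var 0
  | n + 1 => shift 1 (σ n)

/-- Capture-avoiding simultaneous substitution. -/
def subst : (ℕ → VTerm) → VTerm → VTerm
  | σ, var n => σ n
  | σ, lam t => lam (subst (liftSubst σ) t)
  | σ, app t u => app (subst σ t) (subst σ u)
  | σ, jump t u => jump (subst σ t) (subst σ u)

/-- The substitution `{0/u}`, the other variables being lowered by one. -/
def instFun (u : VTerm) : ℕ → VTerm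
  | 0 => u
  | n + 1 => var n

/-- The body `t` of an abstraction `λx.t` with `u` substituted for `x`, i.e. `t{x/u}`. -/
def inst (t u : VTerm) : VTerm := subst (instFun u) t

/-- `t[_/u₁]…[_/uₖ]` for the list `[u₁, …, uₖ]`. -/
def jumps (t : VTerm) (L : List VTerm) : VTerm := L.foldl jump t

end VTerm

open VTerm

/-- One-hole contexts `C ::= □ | λy.C | C v | v C | C[_/v] | v[_/C]`. -/
inductive Ctx : Type
  | hole : Ctx
  | lam : Ctx → Ctx
  | appL : Ctx → VTerm → Ctx
  | appR : VTerm → Ctx → Ctx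
  | jumpL : Ctx → VTerm → Ctx
  | jumpR : VTerm → Ctx → Ctx

namespace Ctx

/-- `C⟨t⟩`; the binders of `C` above the hole may capture variables of `t`. -/
def fill : Ctx → VTerm → VTerm
  | hole, t => t
  | lam C, t => VTerm.lam (fill C t)
  | appL C v, t => VTerm.app (fill C t) v
  | appR v C, t => VTerm.app v (fill C t)
  | jumpL C v, t => VTerm.jump (fill C t) v
  | jumpR v C, t => VTerm.jump v (fill C t)

/-- The number of binders of `C` above its hole. A term `u` living outside `C` and not bound
by `C` is written `u.shift C.depth` when it is placed in the hole. -/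
def depth : Ctx → ℕ
  | hole => 0
  | lam C => depth C + 1
  | appL C _ => depth C
  | appR _ C => depth C
  | jumpL C _ => depth C
  | jumpR _ C => depth C

/-- Boxed contexts `B ::= t C | t[_/C] | B t | B[_/t] | λy.B`. -/
def Boxed : Ctx → Prop
  | hole => False
  | lam B => Boxed B
  | appL B _ => Boxed B
  | appR _ _ => True
  | jumpL B _ => Boxed B
  | jumpR _ _ => True

end Ctx

/-- `v ◁ u` and `fv v ⊆ fv u`: `v` occurs in `u` as a strict subterm, and no variable of this
occurrence is bound in `u` by an abstraction above it. -/
def FreeSubterm (v u : VTerm) : Prop :=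
  ∃ C : Ctx, C ≠ Ctx.hole ∧ u = C.fill (v.shift C.depth)

/-- Closure of a relation under all contexts. -/
def CtxClosure (R : VTerm → VTerm → Prop) (t u : VTerm) : Prop :=
  ∃ (C : Ctx) (a b : VTerm), R a b ∧ t = C.fill a ∧ u = C.fill b

/-- `s` is strongly normalising for `R`: there is no infinite `R`-sequence from `s`. -/
def SN {A : Type*} (R : A → A → Prop) (s : A) : Prop :=
  ¬ ∃ f : ℕ → A, f 0 = s ∧ ∀ n, R (f n) (f (n + 1))

/-- The rule `(λx.t) u ↦ t{x/u}` of the `λ`-calculus. -/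
inductive LambdaBetaRule : VTerm → VTerm → Prop
  | beta (t u : VTerm) : LambdaBetaRule (app (lam t) u) (t.inst u)

/-- `β`-reduction of the `λ`-calculus; on `λ`-terms only contexts without jumps matter. -/
def LambdaBeta : VTerm → VTerm → Prop := CtxClosure LambdaBetaRule

/-- The rules `β`, `dB`, `h`, `u` of the memory calculus. -/
inductive Rule : VTerm → VTerm → Prop
  /-- `(λx.t) L u ↦ t{x/u} L` if `x ∈ fv t`. -/
  | beta (t u : VTerm) (L : List VTerm) : 0 ∈ t.fv →
      Rule (app ((lam t).jumps L) u) ((t.inst u).jumps L)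
  /-- `(λx.t) L u ↦ t[_/u] L` if `x ∉ fv t`. -/
  | dB (t u : VTerm) (L : List VTerm) :
      Rule (app ((lam (t.shift 1)).jumps L) u) ((jump t u).jumps L)
  /-- `t[_/u] ↦ t[_/u₁]…[_/uₙ]` if `uᵢ ◁ u` and `fv uᵢ ⊆ fv u` for all `i`, with `n ≥ 0`. -/
  | h (t u : VTerm) (L : List VTerm) : (∀ v ∈ L, FreeSubterm v u) →
      Rule (jump t u) (t.jumps L)
  /-- `B⟨t[_/u]⟩ ↦ B⟨t⟩[_/u]` if `B` is boxed and does not bind `u`. -/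
  | unbox (B : Ctx) (t u : VTerm) : B.Boxed →
      Rule (B.fill (jump t (u.shift B.depth))) (jump (B.fill t) u)

/-- The equations generating the graphical equivalence. -/
inductive EqnO : VTerm → VTerm → Prop
  /-- `t[_/s][_/v] ∼ t[_/v][_/s]`. -/
  | cs (t s v : VTerm) : EqnO (jump (jump t s) v) (jump (jump t v) s)
  /-- `λy.(t[_/s]) ∼ (λy.t)[_/s]` if `y ∉ fv s`. -/
  | sigma1 (t s : VTerm) : EqnO (lam (jump t (s.shift 1))) (jump (lam t) s)
  /-- `t[_/s] v ∼ (t v)[_/s]`. -/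
  | sigma2 (t s v : VTerm) : EqnO (app (jump t s) v) (jump (app t v) s)

/-- The graphical equivalence: the least equivalence closed under contexts that contains the
equations. -/
def EquivO : VTerm → VTerm → Prop := Relation.EqvGen (CtxClosure EqnO)

/-- Reduction of the memory calculus, before passing to the quotient. -/
def Step : VTerm → VTerm → Prop := CtxClosure Rule

/-- Reduction of the memory calculus modulo the graphical equivalence. -/
def StepO (t u : VTerm) : Prop :=
  ∃ t' u', EquivO t t' ∧ Step t' u' ∧ EquivO u' u

/-- `Γ ∪ {x}`, in the scope of one more binder, for `x`. -/
def extend (Γ : Set ℕ) : Set ℕ := {0} ∪ Nat.succ '' Γ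

open Classical in
/-- The trunk of a term with respect to the variables `Γ`: all jumps that are on the surface,
or can get there, are removed. -/
noncomputable def trunk : Set ℕ → VTerm → VTerm
  | _, var n => var n
  | Γ, app t u => app (trunk Γ t) u
  | Γ, lam t => lam (trunk (extend Γ) t)
  | Γ, jump t u => if u.fv ∩ Γ = ∅ then trunk Γ t else jump (trunk Γ t) u

/-- All surface jumps of a term, with respect to the variables `Γ`, contain strongly
normalising terms. -/
def SurfaceSN : Set ℕ → VTerm → Prop
  | _, var _ => True
  | Γ, app t _ => SurfaceSN Γ t
  | Γ, lam t => SurfaceSN (extend Γ) t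
  | Γ, jump t u => SurfaceSN Γ t ∧ (u.fv ∩ Γ = ∅ → SN StepO u)

end VoidJumps

/-! Both statements rest on `StepAcc.jump`: if `s` and `u` are strongly normalising, so is `s[_/u]`.
A void jump substitutes nothing, so a jump on the surface of a term never interacts with the rest.
By `Surf.red`, a step from a term equivalent to `s[_/u]` either is a step of `s` that keeps the
jump, or acts on `u` alone and replaces `[_/u]` by finitely many jumps on reducts or free strict
subterms of `u`. The union of reduction and free strict subterms is well-founded below a normalising
`u` (`StepAcc.acc_argLt`), so an induction on `u`, then on `s`, concludes.

For VIE, every surface jump can be moved to the root by the equivalence, because its content avoids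
the binders above it. A term is thus equivalent to its trunk followed by normalising jumps
(`SurfaceSN.exists_jumps`), and `StepAcc.jump` is iterated.

For PSN, the induction is on `β`-reduction together with immediate subterms. A `λ`-term is an
abstraction, a variable applied to arguments, or has a head redex. Each case is dominated by a term
already known to be normalising, in the sense of `StepAcc.of_simulation`: the body of the
abstraction; the head variable with its arguments turned into jumps; or, for `(λx.a) u v₁…vₙ`, the
term `a{x/u}[_/u] v₁…vₙ`. The last one is equivalent to the head `β`-reduct followed by `[_/u]`, so
the induction hypothesis and `StepAcc.jump` apply. The jump `[_/u]` is kept even when `x` occurs in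
`a`, so that each step inside `u` is matched by at least one step. -/

namespace VoidJumps
open VTerm Relation

/-! ### Renaming, substitution and free variables -/

namespace VTerm

theorem rename_rename (ξ ζ : ℕ → ℕ) (t : VTerm) :
    rename ξ (rename ζ t) = rename (fun n => ξ (ζ n)) t := by
  induction t generalizing ξ ζ with
  | var n => rfl
  | lam t ih =>
    simp only [rename, ih]
    congr 2; funext n; cases n <;> rfl
  | app t u iht ihu => simp only [rename, iht, ihu]
  | jump t u iht ihu => simp only [rename, iht, ihu]

theorem rename_id (t : VTerm) : rename (fun n => n) t = t := by
  induction t with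
  | var n => rfl
  | lam t ih =>
    have : liftRen (fun n => n) = fun n => n := by funext n; cases n <;> rfl
    simp only [rename, this, ih]
  | app t u iht ihu => simp only [rename, iht, ihu]
  | jump t u iht ihu => simp only [rename, iht, ihu]

theorem rename_eq_subst (ξ : ℕ → ℕ) (t : VTerm) :
    rename ξ t = subst (fun n => var (ξ n)) t := by
  induction t generalizing ξ with
  | var n => rfl
  | lam t ih =>
    simp only [rename, subst, ih]
    congr 2; funext n; cases n <;> rfl
  | app t u iht ihu => simp only [rename, subst, iht, ihu]
  | jump t u iht ihu => simp only [rename, subst, iht, ihu]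

theorem subst_rename (σ : ℕ → VTerm) (ξ : ℕ → ℕ) (t : VTerm) :
    subst σ (rename ξ t) = subst (fun n => σ (ξ n)) t := by
  induction t generalizing σ ξ with
  | var n => rfl
  | lam t ih =>
    simp only [rename, subst, ih]
    congr 2; funext n; cases n <;> rfl
  | app t u iht ihu => simp only [rename, subst, iht, ihu]
  | jump t u iht ihu => simp only [rename, subst, iht, ihu]

theorem rename_subst (ξ : ℕ → ℕ) (σ : ℕ → VTerm) (t : VTerm) :
    rename ξ (subst σ t) = subst (fun n => rename ξ (σ n)) t := by
  induction t generalizing σ ξ with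
  | var n => rfl
  | lam t ih =>
    simp only [rename, subst, ih]
    congr 2; funext n
    cases n with
    | zero => rfl
    | succ n => simp only [liftSubst, shift, rename_rename]; rfl
  | app t u iht ihu => simp only [rename, subst, iht, ihu]
  | jump t u iht ihu => simp only [rename, subst, iht, ihu]

theorem subst_shift_one (σ : ℕ → VTerm) (t : VTerm) :
    subst (liftSubst σ) (shift 1 t) = shift 1 (subst σ t) := by
  simp only [shift, subst_rename, rename_subst]; rfl

theorem subst_subst (τ σ : ℕ → VTerm) (t : VTerm) :
    subst τ (subst σ t) = subst (fun n => subst τ (σ n)) t := by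
  induction t generalizing σ τ with
  | var n => rfl
  | lam t ih =>
    simp only [subst, ih]
    congr 2; funext n
    cases n with
    | zero => rfl
    | succ n => exact subst_shift_one τ (σ n)
  | app t u iht ihu => simp only [subst, iht, ihu]
  | jump t u iht ihu => simp only [subst, iht, ihu]

theorem subst_congr {σ τ : ℕ → VTerm} {t : VTerm} (h : ∀ n ∈ t.fv, σ n = τ n) :
    subst σ t = subst τ t := by
  induction t generalizing σ τ with
  | var n => exact h n rfl
  | lam t ih =>
    simp only [subst]
    rw [ih]
    intro n hn
    cases n with
    | zero => rfl
    | succ n => simp only [liftSubst, h n hn]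
  | app t u iht ihu =>
    simp only [subst, iht fun n hn => h n (Or.inl hn), ihu fun n hn => h n (Or.inr hn)]
  | jump t u iht ihu =>
    simp only [subst, iht fun n hn => h n (Or.inl hn), ihu fun n hn => h n (Or.inr hn)]

theorem subst_var (t : VTerm) : subst var t = t := by
  rw [← rename_eq_subst (fun n => n), rename_id]

theorem subst_inst (σ : ℕ → VTerm) (a b : VTerm) :
    subst σ (inst a b) = inst (subst (liftSubst σ) a) (subst σ b) := by
  simp only [inst, subst_subst]
  congr 1; funext n
  cases n with
  | zero => rfl
  | succ n => simp [liftSubst, instFun, subst, shift, subst_rename, subst_var]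

theorem inst_shift_one (t b : VTerm) : inst (shift 1 t) b = t := by
  simp [inst, shift, subst_rename, instFun, subst_var]

theorem shift_one_inj {t u : VTerm} (h : shift 1 t = shift 1 u) : t = u := by
  rw [← inst_shift_one t (var 0), h, inst_shift_one]

/-- Instantiating a variable that does not occur only lowers the other indices, whatever `b` is.
This serves as the inverse of `shift 1` throughout. -/
theorem shift_one_inst {a : VTerm} (b : VTerm) (h : 0 ∉ a.fv) : shift 1 (inst a b) = a := by
  rw [inst, shift, rename_subst]
  conv_rhs => rw [← subst_var a]
  apply subst_congr
  intro n hn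
  cases n with
  | zero => exact absurd hn h
  | succ n => rfl

theorem shift_zero (t : VTerm) : shift 0 t = t := rename_id t

theorem shift_shift (k l : ℕ) (t : VTerm) : shift k (shift l t) = shift (l + k) t := by
  simp only [shift, rename_rename, Nat.add_assoc]

theorem mem_fv_rename {ξ : ℕ → ℕ} {t : VTerm} {n : ℕ} :
    n ∈ (rename ξ t).fv ↔ ∃ m ∈ t.fv, ξ m = n := by
  induction t generalizing ξ n with
  | var k => simp [rename, fv, eq_comm]
  | lam t ih =>
    simp only [rename, fv, Set.mem_ofPred_eq, ih]
    constructor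
    · rintro ⟨m, hm, h⟩
      cases m with
      | zero => simp [liftRen] at h
      | succ m => exact ⟨m, hm, Nat.succ_injective h⟩
    · rintro ⟨m, hm, h⟩
      exact ⟨m + 1, hm, congrArg (· + 1) h⟩
  | app t u iht ihu => simp only [rename, fv, Set.mem_union, iht, ihu, or_and_right, exists_or]
  | jump t u iht ihu => simp only [rename, fv, Set.mem_union, iht, ihu, or_and_right, exists_or]

theorem mem_fv_shift_one {t : VTerm} {n : ℕ} : n + 1 ∈ (shift 1 t).fv ↔ n ∈ t.fv := by
  simp [shift, mem_fv_rename]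

theorem zero_notMem_fv_shift_one (t : VTerm) : 0 ∉ (shift 1 t).fv := by
  simp [shift, mem_fv_rename]

theorem mem_fv_subst {σ : ℕ → VTerm} {t : VTerm} {n : ℕ} :
    n ∈ (subst σ t).fv ↔ ∃ m ∈ t.fv, n ∈ (σ m).fv := by
  induction t generalizing σ n with
  | var k => simp [subst, fv]
  | lam t ih =>
    simp only [subst, fv, Set.mem_ofPred_eq, ih]
    constructor
    · rintro ⟨m, hm, h⟩
      cases m with
      | zero => simp [liftSubst, fv] at h
      | succ m => exact ⟨m, hm, mem_fv_shift_one.1 h⟩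
    · rintro ⟨m, hm, h⟩
      exact ⟨m + 1, hm, mem_fv_shift_one.2 h⟩
  | app t u iht ihu => simp only [subst, fv, Set.mem_union, iht, ihu, or_and_right, exists_or]
  | jump t u iht ihu => simp only [subst, fv, Set.mem_union, iht, ihu, or_and_right, exists_or]

/-- The side condition separating `β` from `dB` is stable under substitution, so a redex keeps its
kind. -/
theorem zero_mem_fv_subst_lift {σ : ℕ → VTerm} {t : VTerm} :
    0 ∈ (subst (liftSubst σ) t).fv ↔ 0 ∈ t.fv := by
  rw [mem_fv_subst]
  constructor
  · rintro ⟨m, hm, h⟩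
    cases m with
    | zero => exact hm
    | succ m => exact absurd h (zero_notMem_fv_shift_one _)
  · exact fun h => ⟨0, h, rfl⟩

theorem fv_inst_subset (a b : VTerm) : (inst a b).fv ⊆ (lam a).fv ∪ b.fv := by
  intro n hn
  obtain ⟨m, hm, h⟩ := mem_fv_subst.1 hn
  cases m with
  | zero => exact Or.inr h
  | succ m =>
    obtain rfl : n = m := h
    exact Or.inl hm

theorem subst_jumps (σ : ℕ → VTerm) (t : VTerm) (L : List VTerm) :
    subst σ (jumps t L) = jumps (subst σ t) (L.map (subst σ)) := by
  induction L generalizing t with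
  | nil => rfl
  | cons u L ih => exact ih (jump t u)

theorem exists_shift_eq {k : ℕ} {u : VTerm} (h : ∀ n ∈ u.fv, k ≤ n) : ∃ v, shift k v = u := by
  refine ⟨rename (fun n => n - k) u, ?_⟩
  rw [shift, rename_rename, rename_eq_subst]
  conv_rhs => rw [← subst_var u]
  apply subst_congr
  intro n hn
  simp only [Nat.sub_add_cancel (h n hn)]

/-- The number of constructors of a term. -/
def size : VTerm → ℕ
  | var _ => 1
  | lam t => size t + 1
  | app t u => size t + size u + 1
  | jump t u => size t + size u + 1

theorem size_rename (ξ : ℕ → ℕ) (t : VTerm) : (rename ξ t).size = t.size := by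
  induction t generalizing ξ with
  | var n => rfl
  | lam t ih => simp only [rename, size, ih]
  | app t u iht ihu => simp only [rename, size, iht, ihu]
  | jump t u iht ihu => simp only [rename, size, iht, ihu]

theorem size_shift (k : ℕ) (t : VTerm) : (shift k t).size = t.size := size_rename _ t

end VTerm

/-! ### The graphical equivalence -/

/-- One application, in either direction and in any context, of an equation of `EquivO`. -/
inductive EqStep : VTerm → VTerm → Prop
  | cs (t s v) : EqStep (jump (jump t s) v) (jump (jump t v) s)
  | lamOut (t s) : EqStep (lam (jump t (shift 1 s))) (jump (lam t) s)
  | lamIn (t s) : EqStep (jump (lam t) s) (lam (jump t (shift 1 s)))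
  | appOut (t s v) : EqStep (app (jump t s) v) (jump (app t v) s)
  | appIn (t s v) : EqStep (jump (app t v) s) (app (jump t s) v)
  | lam {t t'} : EqStep t t' → EqStep (lam t) (lam t')
  | appL {t t'} (u) : EqStep t t' → EqStep (app t u) (app t' u)
  | appR (t) {u u'} : EqStep u u' → EqStep (app t u) (app t u')
  | jumpL {t t'} (u) : EqStep t t' → EqStep (jump t u) (jump t' u)
  | jumpR (t) {u u'} : EqStep u u' → EqStep (jump t u) (jump t u')

theorem EqStep.symm {t u : VTerm} (h : EqStep t u) : EqStep u t := by
  induction h with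
  | cs t s v => exact .cs t v s
  | lamOut t s => exact .lamIn t s
  | lamIn t s => exact .lamOut t s
  | appOut t s v => exact .appIn t s v
  | appIn t s v => exact .appOut t s v
  | lam _ ih => exact ih.lam
  | appL u _ ih => exact ih.appL u
  | appR t _ ih => exact ih.appR t
  | jumpL u _ ih => exact ih.jumpL u
  | jumpR t _ ih => exact ih.jumpR t

theorem EqStep.reflTransGen_symm {t u : VTerm} (h : ReflTransGen EqStep t u) :
    ReflTransGen EqStep u t := by
  induction h with
  | refl => exact .refl
  | tail _ h ih => exact ih.head h.symm

theorem EqStep.size_eq {t u : VTerm} (h : EqStep t u) : t.size = u.size := by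
  induction h <;> simp only [size, size_shift] at * <;> omega

theorem EqStep.of_ctxClosure {t u : VTerm} (h : CtxClosure EqnO t u) : EqStep t u := by
  obtain ⟨C, a, b, hab, rfl, rfl⟩ := h
  induction C with
  | hole =>
    cases hab with
    | cs t s v => exact .cs t s v
    | sigma1 t s => exact .lamOut t s
    | sigma2 t s v => exact .appOut t s v
  | lam C ih => exact ih.lam
  | appL C v ih => exact ih.appL v
  | appR v C ih => exact ih.appR v
  | jumpL C v ih => exact ih.jumpL v
  | jumpR v C ih => exact ih.jumpR v

theorem CtxClosure.ofBase {R : VTerm → VTerm → Prop} {t u : VTerm} (h : R t u) :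
    CtxClosure R t u :=
  ⟨.hole, t, u, h, rfl, rfl⟩

theorem CtxClosure.lam {R : VTerm → VTerm → Prop} {t u : VTerm} (h : CtxClosure R t u) :
    CtxClosure R (lam t) (lam u) := by
  obtain ⟨C, a, b, hab, rfl, rfl⟩ := h
  exact ⟨.lam C, a, b, hab, rfl, rfl⟩

theorem CtxClosure.appL {R : VTerm → VTerm → Prop} {t u : VTerm} (v : VTerm)
    (h : CtxClosure R t u) : CtxClosure R (app t v) (app u v) := by
  obtain ⟨C, a, b, hab, rfl, rfl⟩ := h
  exact ⟨.appL C v, a, b, hab, rfl, rfl⟩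

theorem CtxClosure.appR {R : VTerm → VTerm → Prop} {t u : VTerm} (v : VTerm)
    (h : CtxClosure R t u) : CtxClosure R (app v t) (app v u) := by
  obtain ⟨C, a, b, hab, rfl, rfl⟩ := h
  exact ⟨.appR v C, a, b, hab, rfl, rfl⟩

theorem CtxClosure.jumpL {R : VTerm → VTerm → Prop} {t u : VTerm} (v : VTerm)
    (h : CtxClosure R t u) : CtxClosure R (jump t v) (jump u v) := by
  obtain ⟨C, a, b, hab, rfl, rfl⟩ := h
  exact ⟨.jumpL C v, a, b, hab, rfl, rfl⟩

theorem CtxClosure.jumpR {R : VTerm → VTerm → Prop} {t u : VTerm} (v : VTerm)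
    (h : CtxClosure R t u) : CtxClosure R (jump v t) (jump v u) := by
  obtain ⟨C, a, b, hab, rfl, rfl⟩ := h
  exact ⟨.jumpR v C, a, b, hab, rfl, rfl⟩

namespace EquivO

theorem refl (t : VTerm) : EquivO t t := EqvGen.refl t

theorem symm {t u : VTerm} (h : EquivO t u) : EquivO u t := EqvGen.symm _ _ h

theorem trans {t u v : VTerm} (h : EquivO t u) (h' : EquivO u v) : EquivO t v :=
  EqvGen.trans _ _ _ h h'

theorem cs (t s v : VTerm) : EquivO (jump (jump t s) v) (jump (jump t v) s) :=
  .rel _ _ (.ofBase (.cs t s v))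

theorem lamOut (t s : VTerm) : EquivO (lam (jump t (shift 1 s))) (jump (lam t) s) :=
  .rel _ _ (.ofBase (.sigma1 t s))

theorem appOut (t s v : VTerm) : EquivO (app (jump t s) v) (jump (app t v) s) :=
  .rel _ _ (.ofBase (.sigma2 t s v))

theorem map {f : VTerm → VTerm}
    (hf : ∀ {a b}, CtxClosure EqnO a b → CtxClosure EqnO (f a) (f b)) {t u : VTerm}
    (h : EquivO t u) : EquivO (f t) (f u) := by
  induction h with
  | rel _ _ h => exact .rel _ _ (hf h)
  | refl _ => exact .refl _
  | symm _ _ _ ih => exact ih.symm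
  | trans _ _ _ _ _ ih ih' => exact ih.trans ih'

theorem lam {t u : VTerm} (h : EquivO t u) : EquivO (lam t) (lam u) := h.map .lam

theorem app {t t' u u' : VTerm} (h : EquivO t t') (h' : EquivO u u') :
    EquivO (app t u) (app t' u') :=
  (h.map (.appL u)).trans (h'.map (.appR t'))

theorem jump {t t' u u' : VTerm} (h : EquivO t t') (h' : EquivO u u') :
    EquivO (jump t u) (jump t' u') :=
  (h.map (.jumpL u)).trans (h'.map (.jumpR t'))

theorem jumps {t t' : VTerm} (h : EquivO t t') (L : List VTerm) :
    EquivO (jumps t L) (jumps t' L) := by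
  induction L generalizing t t' with
  | nil => exact h
  | cons u L ih => exact ih (h.jump (refl u))

/-- Since `EqStep` is symmetric, an equivalence is a chain of single steps; invariants need only be
checked across one `EqStep`. -/
theorem reflTransGen {t u : VTerm} (h : EquivO t u) : ReflTransGen EqStep t u := by
  induction h with
  | rel _ _ h => exact .single (.of_ctxClosure h)
  | refl _ => exact .refl
  | symm _ _ _ ih => exact EqStep.reflTransGen_symm ih
  | trans _ _ _ _ _ ih ih' => exact ih.trans ih'

theorem of_eqStep {t u : VTerm} (h : EqStep t u) : EquivO t u := by
  induction h with
  | cs t s v => exact cs t s v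
  | lamOut t s => exact lamOut t s
  | lamIn t s => exact (lamOut t s).symm
  | appOut t s v => exact appOut t s v
  | appIn t s v => exact (appOut t s v).symm
  | lam _ ih => exact ih.lam
  | appL u _ ih => exact ih.app (refl u)
  | appR t _ ih => exact (refl t).app ih
  | jumpL u _ ih => exact ih.jump (refl u)
  | jumpR t _ ih => exact (refl t).jump ih

theorem size_eq {t u : VTerm} (h : EquivO t u) : t.size = u.size := by
  replace h := h.reflTransGen
  induction h with
  | refl => rfl
  | tail _ h ih => exact ih.trans h.size_eq

theorem subst {t u : VTerm} (σ : ℕ → VTerm) (h : EquivO t u) :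
    EquivO (subst σ t) (subst σ u) := by
  have key : ∀ {t u : VTerm} (σ : ℕ → VTerm), EqStep t u →
      EquivO (VTerm.subst σ t) (VTerm.subst σ u) := by
    intro t u σ h
    induction h generalizing σ with
    | cs t s v => exact cs _ _ _
    | lamOut t s =>
      simp only [VTerm.subst, subst_shift_one]
      exact lamOut _ _
    | lamIn t s =>
      simp only [VTerm.subst, subst_shift_one]
      exact (lamOut _ _).symm
    | appOut t s v => exact appOut _ _ _
    | appIn t s v => exact (appOut _ _ _).symm
    | lam _ ih => exact (ih _).lam
    | appL u _ ih => exact (ih σ).app (refl _)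
    | appR t _ ih => exact (refl _).app (ih σ)
    | jumpL u _ ih => exact (ih σ).jump (refl _)
    | jumpR t _ ih => exact (refl _).jump (ih σ)
  replace h := h.reflTransGen
  induction h with
  | refl => exact refl _
  | tail _ h ih => exact ih.trans (key σ h)

theorem shift {t u : VTerm} (k : ℕ) (h : EquivO t u) : EquivO (shift k t) (shift k u) := by
  simp only [VTerm.shift, rename_eq_subst]
  exact h.subst _

theorem jump_jumps (t u : VTerm) (L : List VTerm) :
    EquivO (VTerm.jump (VTerm.jumps t L) u) (VTerm.jumps (VTerm.jump t u) L) := by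
  induction L generalizing t with
  | nil => exact refl _
  | cons v L ih => exact (ih (VTerm.jump t v)).trans ((cs t v u).jumps L)

theorem app_jumps (t v : VTerm) (L : List VTerm) :
    EquivO (VTerm.app (VTerm.jumps t L) v) (VTerm.jumps (VTerm.app t v) L) := by
  induction L generalizing t with
  | nil => exact refl _
  | cons u L ih => exact (ih (VTerm.jump t u)).trans ((appOut t u v).jumps L)

theorem lam_jumps (t : VTerm) (L : List VTerm) :
    EquivO (VTerm.lam (VTerm.jumps t (L.map (VTerm.shift 1)))) (VTerm.jumps (VTerm.lam t) L) := by
  induction L generalizing t with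
  | nil => exact refl _
  | cons u L ih => exact (ih (VTerm.jump t _)).trans ((lamOut t u).jumps L)

end EquivO

/-- A reflexive relation that is compatible with the constructors and with renaming is
compatible with substitution of related terms. -/
theorem subst_related {R : VTerm → VTerm → Prop} (hvar : ∀ n, R (var n) (var n))
    (hlam : ∀ {t t'}, R t t' → R (lam t) (lam t'))
    (happ : ∀ {t t' u u'}, R t t' → R u u' → R (app t u) (app t' u'))
    (hjump : ∀ {t t' u u'}, R t t' → R u u' → R (jump t u) (jump t' u'))
    (hshift : ∀ {t t'}, R t t' → R (shift 1 t) (shift 1 t'))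
    {σ τ : ℕ → VTerm} (h : ∀ n, R (σ n) (τ n)) (t : VTerm) :
    R (subst σ t) (subst τ t) := by
  induction t generalizing σ τ with
  | var n => exact h n
  | lam t ih =>
    refine hlam (ih fun n => ?_)
    cases n with
    | zero => exact hvar 0
    | succ n => exact hshift (h n)
  | app t u iht ihu => exact happ (iht h) (ihu h)
  | jump t u iht ihu => exact hjump (iht h) (ihu h)

theorem inst_related {R : VTerm → VTerm → Prop} (hvar : ∀ n, R (var n) (var n))
    (hlam : ∀ {t t'}, R t t' → R (lam t) (lam t'))
    (happ : ∀ {t t' u u'}, R t t' → R u u' → R (app t u) (app t' u'))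
    (hjump : ∀ {t t' u u'}, R t t' → R u u' → R (jump t u) (jump t' u'))
    (hshift : ∀ {t t'}, R t t' → R (shift 1 t) (shift 1 t'))
    {b b' : VTerm} (h : R b b') (a : VTerm) : R (inst a b) (inst a b') := by
  refine subst_related hvar hlam happ hjump hshift (fun n => ?_) a
  cases n with
  | zero => exact h
  | succ n => exact hvar n

theorem EquivO.inst {a a' b b' : VTerm} (h : EquivO a a') (h' : EquivO b b') :
    EquivO (inst a b) (inst a' b') :=
  (h.subst _).trans (inst_related (R := EquivO) (fun _ => .refl _) EquivO.lam EquivO.app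
    EquivO.jump (EquivO.shift 1) h' a')

/-! ### Free subterms and extraction of jumps, without explicit contexts -/

/-- `Occurs v u`: `v` is a subterm of `u`, and no variable of this occurrence is bound in `u`. -/
inductive Occurs : VTerm → VTerm → Prop
  | refl (v) : Occurs v v
  | lam {v t} : Occurs (shift 1 v) t → Occurs v (lam t)
  | appL {v t} (u) : Occurs v t → Occurs v (app t u)
  | appR {v u} (t) : Occurs v u → Occurs v (app t u)
  | jumpL {v t} (u) : Occurs v t → Occurs v (jump t u)
  | jumpR {v u} (t) : Occurs v u → Occurs v (jump t u)

/-- Inductive form of `FreeSubterm`. -/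
inductive FreeSub : VTerm → VTerm → Prop
  | lam {v t} : Occurs (shift 1 v) t → FreeSub v (lam t)
  | appL {v t} (u) : Occurs v t → FreeSub v (app t u)
  | appR {v u} (t) : Occurs v u → FreeSub v (app t u)
  | jumpL {v t} (u) : Occurs v t → FreeSub v (jump t u)
  | jumpR {v u} (t) : Occurs v u → FreeSub v (jump t u)

theorem FreeSub.occurs {v u : VTerm} (h : FreeSub v u) : Occurs v u := by
  cases h with
  | lam h => exact .lam h
  | appL u h => exact .appL u h
  | appR t h => exact .appR t h
  | jumpL u h => exact .jumpL u h
  | jumpR t h => exact .jumpR t h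

theorem Occurs.exists_ctx {v u : VTerm} (h : Occurs v u) :
    ∃ C : Ctx, u = C.fill (v.shift C.depth) := by
  induction h with
  | refl v => exact ⟨.hole, (shift_zero v).symm⟩
  | lam _ ih =>
    obtain ⟨C, rfl⟩ := ih
    exact ⟨.lam C, by simp only [Ctx.fill, Ctx.depth, shift_shift, Nat.add_comm]⟩
  | appL u _ ih => obtain ⟨C, rfl⟩ := ih; exact ⟨.appL C u, rfl⟩
  | appR t _ ih => obtain ⟨C, rfl⟩ := ih; exact ⟨.appR t C, rfl⟩
  | jumpL u _ ih => obtain ⟨C, rfl⟩ := ih; exact ⟨.jumpL C u, rfl⟩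
  | jumpR t _ ih => obtain ⟨C, rfl⟩ := ih; exact ⟨.jumpR t C, rfl⟩

theorem Occurs.fill (C : Ctx) (v : VTerm) : Occurs v (C.fill (v.shift C.depth)) := by
  induction C generalizing v with
  | hole =>
    simp only [Ctx.fill, Ctx.depth, shift_zero]
    exact .refl v
  | lam C ih =>
    have := ih (shift 1 v)
    rw [shift_shift, Nat.add_comm] at this
    exact .lam this
  | appL C u ih => exact .appL u (ih v)
  | appR t C ih => exact .appR t (ih v)
  | jumpL C u ih => exact .jumpL u (ih v)
  | jumpR t C ih => exact .jumpR t (ih v)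

theorem FreeSub.freeSubterm {v u : VTerm} (h : FreeSub v u) : FreeSubterm v u := by
  cases h with
  | lam h =>
    obtain ⟨C, rfl⟩ := h.exists_ctx
    exact ⟨.lam C, nofun, by simp only [Ctx.fill, Ctx.depth, shift_shift, Nat.add_comm]⟩
  | appL u h => obtain ⟨C, rfl⟩ := h.exists_ctx; exact ⟨.appL C u, nofun, rfl⟩
  | appR t h => obtain ⟨C, rfl⟩ := h.exists_ctx; exact ⟨.appR t C, nofun, rfl⟩
  | jumpL u h => obtain ⟨C, rfl⟩ := h.exists_ctx; exact ⟨.jumpL C u, nofun, rfl⟩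
  | jumpR t h => obtain ⟨C, rfl⟩ := h.exists_ctx; exact ⟨.jumpR t C, nofun, rfl⟩

theorem FreeSub.of_freeSubterm {v u : VTerm} (h : FreeSubterm v u) : FreeSub v u := by
  obtain ⟨C, hC, rfl⟩ := h
  cases C with
  | hole => exact absurd rfl hC
  | lam C =>
    have := Occurs.fill C (shift 1 v)
    rw [shift_shift, Nat.add_comm] at this
    exact .lam this
  | appL C u => exact .appL u (.fill C v)
  | appR t C => exact .appR t (.fill C v)
  | jumpL C u => exact .jumpL u (.fill C v)
  | jumpR t C => exact .jumpR t (.fill C v)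

theorem Occurs.subst {v u : VTerm} (σ : ℕ → VTerm) (h : Occurs v u) :
    Occurs (subst σ v) (subst σ u) := by
  induction h generalizing σ with
  | refl v => exact .refl _
  | lam _ ih => exact .lam (subst_shift_one σ _ ▸ ih (liftSubst σ))
  | appL u _ ih => exact .appL _ (ih σ)
  | appR t _ ih => exact .appR _ (ih σ)
  | jumpL u _ ih => exact .jumpL _ (ih σ)
  | jumpR t _ ih => exact .jumpR _ (ih σ)

theorem FreeSub.subst {v u : VTerm} (σ : ℕ → VTerm) (h : FreeSub v u) :
    FreeSub (subst σ v) (subst σ u) := by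
  cases h with
  | lam h => exact .lam (subst_shift_one σ _ ▸ h.subst (liftSubst σ))
  | appL u h => exact .appL _ (h.subst σ)
  | appR t h => exact .appR _ (h.subst σ)
  | jumpL u h => exact .jumpL _ (h.subst σ)
  | jumpR t h => exact .jumpR _ (h.subst σ)

theorem Occurs.shift_one {v u : VTerm} (h : Occurs v u) : Occurs (shift 1 v) (shift 1 u) := by
  simp only [shift, rename_eq_subst]
  exact h.subst _

theorem Occurs.trans {v u t : VTerm} (h : Occurs v u) (h' : Occurs u t) : Occurs v t := by
  induction h' generalizing v with
  | refl u => exact h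
  | lam _ ih => exact .lam (ih h.shift_one)
  | appL u _ ih => exact .appL _ (ih h)
  | appR t _ ih => exact .appR _ (ih h)
  | jumpL u _ ih => exact .jumpL _ (ih h)
  | jumpR t _ ih => exact .jumpR _ (ih h)

theorem Occurs.size_le {v u : VTerm} (h : Occurs v u) : v.size ≤ u.size := by
  induction h <;> simp only [size, size_shift, le_refl] at * <;> omega

theorem FreeSub.size_lt {v u : VTerm} (h : FreeSub v u) : v.size < u.size := by
  cases h <;> rename_i h <;> have := h.size_le <;> simp only [size, size_shift] at * <;> omega

theorem Occurs.fv_subset {v u : VTerm} (h : Occurs v u) : v.fv ⊆ u.fv := by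
  induction h with
  | refl v => exact subset_rfl
  | lam _ ih => exact fun n hn => ih (mem_fv_shift_one.2 hn)
  | appL u _ ih => exact fun n hn => Or.inl (ih hn)
  | appR t _ ih => exact fun n hn => Or.inr (ih hn)
  | jumpL u _ ih => exact fun n hn => Or.inl (ih hn)
  | jumpR t _ ih => exact fun n hn => Or.inr (ih hn)

/-- `Extracts t t' w`: `t = C⟨r[_/w]⟩` and `t' = C⟨r⟩` for a context `C` not binding `w`. -/
inductive Extracts : VTerm → VTerm → VTerm → Prop
  | here (r w) : Extracts (jump r w) r w
  | lam {t t' w} : Extracts t t' (shift 1 w) → Extracts (lam t) (lam t') w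
  | appL {t t' w} (u) : Extracts t t' w → Extracts (app t u) (app t' u) w
  | appR {u u' w} (t) : Extracts u u' w → Extracts (app t u) (app t u') w
  | jumpL {t t' w} (u) : Extracts t t' w → Extracts (jump t u) (jump t' u) w
  | jumpR {u u' w} (t) : Extracts u u' w → Extracts (jump t u) (jump t u') w

/-- `Unboxes t t' w`: `t = B⟨r[_/w]⟩` and `t' = B⟨r⟩` for a boxed context `B` not binding `w`. -/
inductive Unboxes : VTerm → VTerm → VTerm → Prop
  | lam {t t' w} : Unboxes t t' (shift 1 w) → Unboxes (lam t) (lam t') w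
  | appL {t t' w} (u) : Unboxes t t' w → Unboxes (app t u) (app t' u) w
  | appR {u u' w} (t) : Extracts u u' w → Unboxes (app t u) (app t u') w
  | jumpL {t t' w} (u) : Unboxes t t' w → Unboxes (jump t u) (jump t' u) w
  | jumpR {u u' w} (t) : Extracts u u' w → Unboxes (jump t u) (jump t u') w

theorem Extracts.fill (C : Ctx) (t w : VTerm) :
    Extracts (C.fill (jump t (w.shift C.depth))) (C.fill t) w := by
  induction C generalizing w with
  | hole =>
    simp only [Ctx.fill, Ctx.depth, shift_zero]
    exact .here t w
  | lam C ih =>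
    have := ih (shift 1 w)
    rw [shift_shift, Nat.add_comm] at this
    exact .lam this
  | appL C u ih => exact .appL u (ih w)
  | appR t C ih => exact .appR t (ih w)
  | jumpL C u ih => exact .jumpL u (ih w)
  | jumpR t C ih => exact .jumpR t (ih w)

theorem Unboxes.fill {B : Ctx} (hB : B.Boxed) (t w : VTerm) :
    Unboxes (B.fill (jump t (w.shift B.depth))) (B.fill t) w := by
  induction B generalizing w with
  | hole => exact hB.elim
  | lam C ih =>
    have := ih hB (shift 1 w)
    rw [shift_shift, Nat.add_comm] at this
    exact .lam this
  | appL C u ih => exact .appL u (ih hB w)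
  | appR t C ih => exact .appR t (.fill C _ w)
  | jumpL C u ih => exact .jumpL u (ih hB w)
  | jumpR t C ih => exact .jumpR t (.fill C _ w)

theorem Extracts.exists_ctx {t t' w : VTerm} (h : Extracts t t' w) :
    ∃ (C : Ctx) (r : VTerm), t = C.fill (jump r (w.shift C.depth)) ∧ t' = C.fill r := by
  induction h with
  | here r w => exact ⟨.hole, r, by simp only [Ctx.fill, Ctx.depth, shift_zero], rfl⟩
  | lam _ ih =>
    obtain ⟨C, r, rfl, rfl⟩ := ih
    exact ⟨.lam C, r, by simp only [Ctx.fill, Ctx.depth, shift_shift, Nat.add_comm], rfl⟩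
  | appL u _ ih => obtain ⟨C, r, rfl, rfl⟩ := ih; exact ⟨.appL C u, r, rfl, rfl⟩
  | appR t _ ih => obtain ⟨C, r, rfl, rfl⟩ := ih; exact ⟨.appR t C, r, rfl, rfl⟩
  | jumpL u _ ih => obtain ⟨C, r, rfl, rfl⟩ := ih; exact ⟨.jumpL C u, r, rfl, rfl⟩
  | jumpR t _ ih => obtain ⟨C, r, rfl, rfl⟩ := ih; exact ⟨.jumpR t C, r, rfl, rfl⟩

theorem Unboxes.exists_ctx {t t' w : VTerm} (h : Unboxes t t' w) :
    ∃ (B : Ctx) (r : VTerm),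
      B.Boxed ∧ t = B.fill (jump r (w.shift B.depth)) ∧ t' = B.fill r := by
  induction h with
  | lam _ ih =>
    obtain ⟨C, r, hC, rfl, rfl⟩ := ih
    exact ⟨.lam C, r, hC, by simp only [Ctx.fill, Ctx.depth, shift_shift, Nat.add_comm], rfl⟩
  | appL u _ ih => obtain ⟨C, r, hC, rfl, rfl⟩ := ih; exact ⟨.appL C u, r, hC, rfl, rfl⟩
  | appR t h =>
    obtain ⟨C, r, rfl, rfl⟩ := h.exists_ctx; exact ⟨.appR t C, r, trivial, rfl, rfl⟩
  | jumpL u _ ih => obtain ⟨C, r, hC, rfl, rfl⟩ := ih; exact ⟨.jumpL C u, r, hC, rfl, rfl⟩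
  | jumpR t h =>
    obtain ⟨C, r, rfl, rfl⟩ := h.exists_ctx; exact ⟨.jumpR t C, r, trivial, rfl, rfl⟩

theorem Extracts.subst {t t' w : VTerm} (σ : ℕ → VTerm) (h : Extracts t t' w) :
    Extracts (subst σ t) (subst σ t') (subst σ w) := by
  induction h generalizing σ with
  | here r w => exact .here _ _
  | lam _ ih => exact .lam (subst_shift_one σ _ ▸ ih (liftSubst σ))
  | appL u _ ih => exact .appL _ (ih σ)
  | appR t _ ih => exact .appR _ (ih σ)
  | jumpL u _ ih => exact .jumpL _ (ih σ)
  | jumpR t _ ih => exact .jumpR _ (ih σ)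

theorem Unboxes.subst {t t' w : VTerm} (σ : ℕ → VTerm) (h : Unboxes t t' w) :
    Unboxes (subst σ t) (subst σ t') (subst σ w) := by
  induction h generalizing σ with
  | lam _ ih => exact .lam (subst_shift_one σ _ ▸ ih (liftSubst σ))
  | appL u _ ih => exact .appL _ (ih σ)
  | appR t h => exact .appR _ (h.subst σ)
  | jumpL u _ ih => exact .jumpL _ (ih σ)
  | jumpR t h => exact .jumpR _ (h.subst σ)

theorem Extracts.freeSub {t t' w : VTerm} (h : Extracts t t' w) : FreeSub w t := by
  induction h with
  | here r w => exact .jumpR r (.refl w)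
  | lam _ ih => exact .lam ih.occurs
  | appL u _ ih => exact .appL u ih.occurs
  | appR t _ ih => exact .appR t ih.occurs
  | jumpL u _ ih => exact .jumpL u ih.occurs
  | jumpR t _ ih => exact .jumpR t ih.occurs

theorem Unboxes.extracts {t t' w : VTerm} (h : Unboxes t t' w) : Extracts t t' w := by
  induction h with
  | lam _ ih => exact .lam ih
  | appL u _ ih => exact .appL u ih
  | appR t h => exact .appR t h
  | jumpL u _ ih => exact .jumpL u ih
  | jumpR t h => exact .jumpR t h

theorem Extracts.fv_subset {t t' w : VTerm} (h : Extracts t t' w) : t'.fv ⊆ t.fv := by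
  induction h with
  | here r w => exact fun n hn => Or.inl hn
  | lam _ ih => exact fun n hn => ih hn
  | appL u _ ih => exact Set.union_subset_union_left _ ih
  | appR t _ ih => exact Set.union_subset_union_right _ ih
  | jumpL u _ ih => exact Set.union_subset_union_left _ ih
  | jumpR t _ ih => exact Set.union_subset_union_right _ ih

/-! ### Inductive presentation of reduction -/

/-- `Fires f u c`: the application `f u` is a redex for `β` or `dB`, with contractum `c`. -/
inductive Fires : VTerm → VTerm → VTerm → Prop
  | beta {a : VTerm} (u) : 0 ∈ a.fv → Fires (lam a) u (inst a u)
  | dB {a : VTerm} (u) : 0 ∉ a.fv → Fires (lam a) u (jump (inst a u) u)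
  | jump {f u c} (s) : Fires f u c → Fires (jump f s) u (jump c s)

/-- Inductive form of `Step`. -/
inductive Red : VTerm → VTerm → Prop
  | fire {f u c} : Fires f u c → Red (app f u) c
  | h {u L} (t) : (∀ v ∈ L, FreeSub v u) → Red (jump t u) (jumps t L)
  | unbox {t t' w} : Unboxes t t' w → Red t (jump t' w)
  | lam {t t'} : Red t t' → Red (lam t) (lam t')
  | appL {t t'} (u) : Red t t' → Red (app t u) (app t' u)
  | appR (t) {u u'} : Red u u' → Red (app t u) (app t u')
  | jumpL {t t'} (u) : Red t t' → Red (jump t u) (jump t' u)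
  | jumpR (t) {u u'} : Red u u' → Red (jump t u) (jump t u')

theorem Fires.jumps {f u c : VTerm} (h : Fires f u c) (L : List VTerm) :
    Fires (jumps f L) u (jumps c L) := by
  induction L generalizing f c with
  | nil => exact h
  | cons s L ih => exact ih (h.jump s)

theorem Fires.rule {f u c : VTerm} (h : Fires f u c) : Rule (app f u) c := by
  have key : ∃ L t, f = VTerm.jumps (lam t) L ∧ (0 ∈ t.fv ∧ c = VTerm.jumps (inst t u) L ∨
      0 ∉ t.fv ∧ c = VTerm.jumps (VTerm.jump (inst t u) u) L) := by
    induction h with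
    | beta u h => exact ⟨[], _, rfl, .inl ⟨h, rfl⟩⟩
    | dB u h => exact ⟨[], _, rfl, .inr ⟨h, rfl⟩⟩
    | jump s _ ih =>
      obtain ⟨L, t, rfl, h⟩ := ih
      refine ⟨L ++ [s], t, by simp [VTerm.jumps], h.imp ?_ ?_⟩ <;>
      · rintro ⟨h0, rfl⟩
        exact ⟨h0, by simp [VTerm.jumps]⟩
  obtain ⟨L, t, rfl, ⟨h0, rfl⟩ | ⟨h0, rfl⟩⟩ := key
  · exact .beta t u L h0
  -- `Rule.dB` is phrased for a shifted body; as `0` is not free in `t`, `t` is the shift of `inst t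
  -- u`.
  · have := Rule.dB (inst t u) u L
    rwa [shift_one_inst u h0] at this

theorem Fires.subst {f u c : VTerm} (σ : ℕ → VTerm) (h : Fires f u c) :
    Fires (subst σ f) (subst σ u) (subst σ c) := by
  induction h with
  | beta u h =>
    rw [subst_inst]
    exact .beta _ (zero_mem_fv_subst_lift.2 h)
  | dB u h =>
    simp only [VTerm.subst]
    rw [subst_inst]
    exact .dB _ (mt zero_mem_fv_subst_lift.1 h)
  | jump s _ ih => exact .jump _ ih

theorem Fires.fv_subset {f u c : VTerm} (h : Fires f u c) : c.fv ⊆ f.fv ∪ u.fv := by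
  induction h with
  | beta u h => exact fv_inst_subset _ _
  | dB u h => exact Set.union_subset (fv_inst_subset _ _) (fun n hn => Or.inr hn)
  | jump s _ ih =>
    refine Set.union_subset (fun n hn => ?_) fun n hn => Or.inl (Or.inr hn)
    exact (ih hn).imp Or.inl id

theorem Red.of_step {t u : VTerm} (h : Step t u) : Red t u := by
  obtain ⟨C, a, b, hab, rfl, rfl⟩ := h
  induction C with
  | hole =>
    cases hab with
    | beta t u L h => exact .fire (Fires.jumps (.beta u h) L)
    | dB t u L =>
      refine .fire (Fires.jumps ?_ L)
      have := Fires.dB u (zero_notMem_fv_shift_one t)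
      rwa [inst_shift_one] at this
    | h t u L h => exact .h t fun v hv => .of_freeSubterm (h v hv)
    | unbox B t u hB => exact .unbox (.fill hB t u)
  | lam C ih => exact ih.lam
  | appL C v ih => exact ih.appL v
  | appR v C ih => exact ih.appR v
  | jumpL C v ih => exact ih.jumpL v
  | jumpR v C ih => exact ih.jumpR v

theorem Red.step {t u : VTerm} (h : Red t u) : Step t u := by
  induction h with
  | fire h => exact .ofBase h.rule
  | h t h => exact .ofBase (.h _ _ _ fun v hv => (h v hv).freeSubterm)
  | unbox h =>
    obtain ⟨B, r, hB, rfl, rfl⟩ := h.exists_ctx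
    exact .ofBase (.unbox B r _ hB)
  | lam _ ih => exact CtxClosure.lam ih
  | appL u _ ih => exact CtxClosure.appL u ih
  | appR t _ ih => exact CtxClosure.appR t ih
  | jumpL u _ ih => exact CtxClosure.jumpL u ih
  | jumpR t _ ih => exact CtxClosure.jumpR t ih

theorem Red.subst {t u : VTerm} (σ : ℕ → VTerm) (h : Red t u) :
    Red (subst σ t) (subst σ u) := by
  induction h generalizing σ with
  | fire h => exact .fire (h.subst σ)
  | h t h =>
    rw [subst_jumps]
    refine .h _ fun v hv => ?_
    obtain ⟨w, hw, rfl⟩ := List.mem_map.1 hv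
    exact (h w hw).subst σ
  | unbox h => exact .unbox (h.subst σ)
  | lam _ ih => exact .lam (ih _)
  | appL u _ ih => exact .appL _ (ih σ)
  | appR t _ ih => exact .appR _ (ih σ)
  | jumpL u _ ih => exact .jumpL _ (ih σ)
  | jumpR t _ ih => exact .jumpR _ (ih σ)

theorem mem_fv_jumps {n : ℕ} {t : VTerm} {L : List VTerm} :
    n ∈ (jumps t L).fv ↔ n ∈ t.fv ∨ ∃ v ∈ L, n ∈ v.fv := by
  induction L generalizing t with
  | nil => simp [jumps]
  | cons u L ih =>
    have : jumps t (u :: L) = jumps (jump t u) L := rfl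
    simp [this, ih, fv, or_assoc]

theorem Red.fv_subset {t u : VTerm} (h : Red t u) : u.fv ⊆ t.fv := by
  induction h with
  | fire h => exact h.fv_subset
  | h t h =>
    intro n hn
    refine (mem_fv_jumps.1 hn).imp id ?_
    rintro ⟨v, hv, hn⟩
    exact (h v hv).occurs.fv_subset hn
  | unbox h =>
    exact Set.union_subset h.extracts.fv_subset h.extracts.freeSub.occurs.fv_subset
  | lam _ ih => exact fun n hn => ih hn
  | appL u _ ih => exact Set.union_subset_union_left _ ih
  | appR t _ ih => exact Set.union_subset_union_right _ ih
  | jumpL u _ ih => exact Set.union_subset_union_left _ ih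
  | jumpR t _ ih => exact Set.union_subset_union_right _ ih

/-- The rule `h` with no replacement erases the jump instead of moving it out. -/
theorem Extracts.red {t t' w : VTerm} (h : Extracts t t' w) : Red t t' := by
  induction h with
  | here r w => exact .h (L := []) r (by simp)
  | lam _ ih => exact ih.lam
  | appL u _ ih => exact ih.appL u
  | appR t _ ih => exact ih.appR t
  | jumpL u _ ih => exact ih.jumpL u
  | jumpR t _ ih => exact ih.jumpR t

namespace StepO

theorem of_red {t u : VTerm} (h : Red t u) : StepO t u := ⟨t, u, .refl t, h.step, .refl u⟩

theorem exists_red {t u : VTerm} (h : StepO t u) :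
    ∃ t' u', EquivO t t' ∧ Red t' u' ∧ EquivO u' u := by
  obtain ⟨t', u', h1, h2, h3⟩ := h
  exact ⟨t', u', h1, .of_step h2, h3⟩

theorem equiv_left {t t' u : VTerm} (h : EquivO t t') (h' : StepO t' u) : StepO t u := by
  obtain ⟨a, b, h1, h2, h3⟩ := h'
  exact ⟨a, b, h.trans h1, h2, h3⟩

theorem equiv_right {t u u' : VTerm} (h : StepO t u) (h' : EquivO u u') : StepO t u' := by
  obtain ⟨a, b, h1, h2, h3⟩ := h
  exact ⟨a, b, h1, h2, h3.trans h'⟩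

theorem map {f : VTerm → VTerm} (he : ∀ {a b}, EquivO a b → EquivO (f a) (f b))
    (hr : ∀ {a b}, Red a b → Red (f a) (f b)) {t u : VTerm} (h : StepO t u) :
    StepO (f t) (f u) := by
  obtain ⟨a, b, h1, h2, h3⟩ := h.exists_red
  exact ⟨f a, f b, he h1, (hr h2).step, he h3⟩

theorem lam {t u : VTerm} (h : StepO t u) : StepO (lam t) (lam u) := h.map .lam .lam

theorem appL {t u : VTerm} (v : VTerm) (h : StepO t u) : StepO (app t v) (app u v) :=
  h.map (fun h => h.app (.refl v)) (.appL v)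

theorem appR {t u : VTerm} (v : VTerm) (h : StepO t u) : StepO (app v t) (app v u) :=
  h.map (fun h => (EquivO.refl v).app h) (.appR v)

theorem jumpL {t u : VTerm} (v : VTerm) (h : StepO t u) : StepO (jump t v) (jump u v) :=
  h.map (fun h => h.jump (.refl v)) (.jumpL v)

theorem jumpR {t u : VTerm} (v : VTerm) (h : StepO t u) : StepO (jump v t) (jump v u) :=
  h.map (fun h => (EquivO.refl v).jump h) (.jumpR v)

theorem subst {t u : VTerm} (σ : ℕ → VTerm) (h : StepO t u) :
    StepO (subst σ t) (subst σ u) :=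
  h.map (.subst σ) (.subst σ)

theorem shift {t u : VTerm} (k : ℕ) (h : StepO t u) : StepO (shift k t) (shift k u) := by
  simp only [VTerm.shift, rename_eq_subst]
  exact h.subst _

/-- Every copy of `b` is reduced in turn; there may be no copy at all, hence the reflexive closure.
-/
theorem reflTransGen_inst (a : VTerm) {b b' : VTerm} (h : StepO b b') :
    ReflTransGen StepO (inst a b) (inst a b') := by
  refine inst_related (R := ReflTransGen StepO) (fun _ => .refl) ?_ ?_ ?_ ?_ (.single h) a
  · exact fun h => ReflTransGen.lift VTerm.lam (fun _ _ => lam) _ _ h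
  · exact fun {t t' u u'} h h' => (ReflTransGen.lift (app · u) (fun _ _ => appL u) _ _ h).trans
      (ReflTransGen.lift (app t' ·) (fun _ _ => appR t') _ _ h')
  · exact fun {t t' u u'} h h' => (ReflTransGen.lift (jump · u) (fun _ _ => jumpL u) _ _ h).trans
      (ReflTransGen.lift (jump t' ·) (fun _ _ => jumpR t') _ _ h')
  · exact fun h => ReflTransGen.lift (VTerm.shift 1) (fun _ _ => shift 1) _ _ h

end StepO

/-! ### Steps from abstractions, applications and jumps -/

/-- `JumpRed u L`: acting on `u` alone, one step turns a jump `[_/u]` into the jumps `L`. -/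
inductive JumpRed : VTerm → List VTerm → Prop
  | sub {u L} : (∀ v ∈ L, FreeSub v u) → JumpRed u L
  | red {u u'} : Red u u' → JumpRed u [u']
  | unbox {u u' w} : Extracts u u' w → JumpRed u [u', w]

theorem JumpRed.red_jumps {u : VTerm} {L : List VTerm} (h : JumpRed u L) (t : VTerm) :
    Red (jump t u) (jumps t L) := by
  cases h with
  | sub h => exact .h t h
  | red h => exact .jumpR t h
  | unbox h => exact .unbox (.jumpR t h)

theorem JumpRed.subst {u : VTerm} {L : List VTerm} (σ : ℕ → VTerm) (h : JumpRed u L) :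
    JumpRed (subst σ u) (L.map (subst σ)) := by
  cases h with
  | sub h =>
    refine .sub fun v hv => ?_
    obtain ⟨w, hw, rfl⟩ := List.mem_map.1 hv
    exact (h w hw).subst σ
  | red h => exact .red (h.subst σ)
  | unbox h => exact .unbox (h.subst σ)

theorem JumpRed.fv_subset {u : VTerm} {L : List VTerm} (h : JumpRed u L) :
    ∀ v ∈ L, v.fv ⊆ u.fv := by
  cases h with
  | sub h => exact fun v hv => (h v hv).occurs.fv_subset
  | red h => simpa using h.fv_subset
  | unbox h => simpa using ⟨h.fv_subset, h.freeSub.occurs.fv_subset⟩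

theorem JumpRed.of_shift_one {u : VTerm} {L : List VTerm} (h : JumpRed (shift 1 u) L) :
    ∃ L', L = L'.map (shift 1) ∧ JumpRed u L' := by
  -- The new jumps have no free variable that `shift 1 u` lacks, so index `0` is absent and they can
  -- be lowered; `var 0` is an arbitrary filler.
  refine ⟨L.map (inst · (var 0)), ?_, ?_⟩
  · rw [List.map_map]
    conv_lhs => rw [← List.map_id L]
    refine List.map_congr_left fun v hv => (shift_one_inst (a := v) (var 0) fun h0 => ?_).symm
    exact zero_notMem_fv_shift_one u (h.fv_subset v hv h0)
  · have := h.subst (instFun (var 0))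
    rwa [← inst, inst_shift_one] at this

theorem JumpRed.shift_one {u : VTerm} {L : List VTerm} (h : JumpRed u L) :
    JumpRed (shift 1 u) (L.map (shift 1)) := by
  have : shift 1 = VTerm.subst fun n => var (n + 1) := funext (rename_eq_subst _)
  rw [this]
  exact h.subst _

/-- Unboxing across the abstraction is, up to the equivalence, unboxing just below it. The same
absorption is used for the left of applications and jumps in the next two lemmas. -/
theorem red_lam_cases {t t' : VTerm} (h : Red (lam t) t') :
    ∃ t1, Red t t1 ∧ EquivO t' (lam t1) := by
  cases h with
  | unbox h =>
    cases h with
    | lam h => exact ⟨_, .unbox h, (EquivO.lamOut _ _).symm⟩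
  | lam h => exact ⟨_, h, .refl _⟩

theorem red_app_cases {t v t' : VTerm} (h : Red (app t v) t') :
    Fires t v t' ∨ (∃ t1, Red t t1 ∧ EquivO t' (app t1 v)) ∨ (∃ v1, Red v v1 ∧ t' = app t v1) ∨
      ∃ v1 w, Extracts v v1 w ∧ t' = jump (app t v1) w := by
  cases h with
  | fire h => exact .inl h
  | unbox h =>
    cases h with
    | appL _ h => exact .inr (.inl ⟨_, .unbox h, (EquivO.appOut _ _ _).symm⟩)
    | appR _ h => exact .inr (.inr (.inr ⟨_, _, h, rfl⟩))
  | appL _ h => exact .inr (.inl ⟨_, h, .refl _⟩)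
  | appR _ h => exact .inr (.inr (.inl ⟨_, h, rfl⟩))

theorem red_jump_cases {t v t' : VTerm} (h : Red (jump t v) t') :
    (∃ t1, Red t t1 ∧ EquivO t' (jump t1 v)) ∨ ∃ L, JumpRed v L ∧ t' = jumps t L := by
  cases h with
  | h _ h => exact .inr ⟨_, .sub h, rfl⟩
  | unbox h =>
    cases h with
    | jumpL _ h => exact .inl ⟨_, .unbox h, EquivO.cs _ _ _⟩
    | jumpR _ h => exact .inr ⟨_, .unbox h, rfl⟩
  | jumpL _ h => exact .inl ⟨_, h, .refl _⟩
  | jumpR _ h => exact .inr ⟨_, .red h, rfl⟩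

theorem EqStep.fv_subset {t u : VTerm} (h : EqStep t u) : t.fv ⊆ u.fv := by
  induction h with
  | cs t s v => simp only [fv, Set.union_right_comm]; exact subset_rfl
  | lamOut t s => exact fun n hn => hn.imp id mem_fv_shift_one.1
  | lamIn t s => exact fun n hn => hn.imp id mem_fv_shift_one.2
  | appOut t s v => simp only [fv, Set.union_right_comm]; exact subset_rfl
  | appIn t s v => simp only [fv, Set.union_right_comm]; exact subset_rfl
  | lam _ ih => exact fun n hn => ih hn
  | appL u _ ih => exact Set.union_subset_union_left _ ih
  | appR t _ ih => exact Set.union_subset_union_right _ ih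
  | jumpL u _ ih => exact Set.union_subset_union_left _ ih
  | jumpR t _ ih => exact Set.union_subset_union_right _ ih

theorem EquivO.fv_eq {t u : VTerm} (h : EquivO t u) : t.fv = u.fv := by
  replace h := h.reflTransGen
  induction h with
  | refl => rfl
  | tail _ h ih => exact ih.trans (h.fv_subset.antisymm h.symm.fv_subset)

/-! ### Tracking one surface jump through the equivalence and through reduction -/

/-- `Surf t s u`: `t` is `s` with one additional jump `[_/u]` on its surface. -/
inductive Surf : VTerm → VTerm → VTerm → Prop
  | here (s u) : Surf (jump s u) s u
  | lam {t s u} : Surf t s (shift 1 u) → Surf (lam t) (lam s) u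
  | app {t s u} (v) : Surf t s u → Surf (app t v) (app s v) u
  | jump {t s u} (v) : Surf t s u → Surf (jump t v) (jump s v) u

theorem surf_lam_cases {t s u : VTerm} (h : Surf (lam t) s u) :
    ∃ s', s = lam s' ∧ Surf t s' (shift 1 u) := by
  cases h with
  | lam h => exact ⟨_, rfl, h⟩

theorem surf_app_cases {t v s u : VTerm} (h : Surf (app t v) s u) :
    ∃ s', s = app s' v ∧ Surf t s' u := by
  cases h with
  | app _ h => exact ⟨_, rfl, h⟩

theorem surf_jump_cases {t v s u : VTerm} (h : Surf (jump t v) s u) :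
    s = t ∧ u = v ∨ ∃ s', s = jump s' v ∧ Surf t s' u := by
  cases h with
  | here => exact .inl ⟨rfl, rfl⟩
  | jump _ h => exact .inr ⟨_, rfl, h⟩

theorem Surf.equiv {t s u : VTerm} (h : Surf t s u) : EquivO t (VTerm.jump s u) := by
  induction h with
  | here s u => exact .refl _
  | lam _ ih => exact ih.lam.trans (.lamOut _ _)
  | app v _ ih => exact (ih.app (.refl v)).trans (.appOut _ _ _)
  | jump v _ ih => exact (ih.jump (.refl v)).trans (.cs _ _ _)

/-- An equation either moves the tracked jump to another surface position, or acts on the rest, or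
acts inside its content. -/
theorem Surf.eqStep {t t' s u : VTerm} (h : Surf t s u) (he : EqStep t t') :
    ∃ s' u', Surf t' s' u' ∧ EquivO s s' ∧ EquivO u u' := by
  induction h generalizing t' with
  | here s u =>
    cases he with
    | cs t a _ => exact ⟨_, _, .jump a (.here t u), .refl _, .refl _⟩
    | lamIn t _ => exact ⟨_, _, .lam (.here t _), .refl _, .refl _⟩
    | appIn t _ v => exact ⟨_, _, .app v (.here t u), .refl _, .refl _⟩
    | jumpL _ h => exact ⟨_, _, .here _ u, .of_eqStep h, .refl _⟩
    | jumpR _ h => exact ⟨_, _, .here s _, .refl _, .of_eqStep h⟩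
  | @lam t s u hs ih =>
    cases he with
    | lamOut t a =>
      obtain ⟨rfl, hu⟩ | ⟨s', rfl, hs'⟩ := surf_jump_cases hs
      · obtain rfl := shift_one_inj hu
        exact ⟨_, _, .here _ _, .refl _, .refl _⟩
      · exact ⟨_, _, .jump a (.lam hs'), .lamOut _ _, .refl _⟩
    | lam h =>
      obtain ⟨s', u', hs', hss, hu⟩ := ih h
      -- The equivalence preserves free variables, so the content still avoids the binder and
      -- remains a shift.
      have hu' : shift 1 (inst u' (var 0)) = u' :=
        shift_one_inst _ (hu.fv_eq ▸ zero_notMem_fv_shift_one u)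
      refine ⟨_, inst u' (var 0), .lam (hu'.symm ▸ hs'), hss.lam, ?_⟩
      have := hu.inst (.refl (var 0))
      rwa [inst_shift_one] at this
  | @app t s u v hs ih =>
    cases he with
    | appOut t a _ =>
      obtain ⟨rfl, rfl⟩ | ⟨s', rfl, hs'⟩ := surf_jump_cases hs
      · exact ⟨_, _, .here _ _, .refl _, .refl _⟩
      · exact ⟨_, _, .jump a (.app v hs'), .appOut _ _ _, .refl _⟩
    | appL _ h =>
      obtain ⟨s', u', hs', hss, hu⟩ := ih h
      exact ⟨_, _, .app v hs', hss.app (.refl v), hu⟩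
    | appR _ h => exact ⟨_, _, .app _ hs, (EquivO.refl s).app (.of_eqStep h), .refl _⟩
  | @jump t s u v hs ih =>
    cases he with
    | cs t a _ =>
      obtain ⟨rfl, rfl⟩ | ⟨s', rfl, hs'⟩ := surf_jump_cases hs
      · exact ⟨_, _, .here _ _, .refl _, .refl _⟩
      · exact ⟨_, _, .jump a (.jump v hs'), .cs _ _ _, .refl _⟩
    | lamIn t _ =>
      obtain ⟨s', rfl, hs'⟩ := surf_lam_cases hs
      exact ⟨_, _, .lam (.jump _ hs'), (EquivO.lamOut _ _).symm, .refl _⟩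
    | appIn t _ w =>
      obtain ⟨s', rfl, hs'⟩ := surf_app_cases hs
      exact ⟨_, _, .app w (.jump v hs'), (EquivO.appOut _ _ _).symm, .refl _⟩
    | jumpL _ h =>
      obtain ⟨s', u', hs', hss, hu⟩ := ih h
      exact ⟨_, _, .jump v hs', hss.jump (.refl v), hu⟩
    | jumpR _ h => exact ⟨_, _, .jump _ hs, (EquivO.refl s).jump (.of_eqStep h), .refl _⟩

theorem Surf.of_equiv {t s u : VTerm} (h : EquivO (VTerm.jump s u) t) :
    ∃ s' u', Surf t s' u' ∧ EquivO s s' ∧ EquivO u u' := by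
  replace h := h.reflTransGen
  induction h with
  | refl => exact ⟨s, u, .here s u, .refl s, .refl u⟩
  | tail _ h ih =>
    obtain ⟨s1, u1, h1, hs1, hu1⟩ := ih
    obtain ⟨s2, u2, h2, hs2, hu2⟩ := h1.eqStep h
    exact ⟨s2, u2, h2, hs1.trans hs2, hu1.trans hu2⟩

/-- The tracked jump lies either in the list `L` of the redex or on the surface of the body. In the
latter case its content avoids the bound variable: the substitution leaves it intact, and it does
not affect the choice between `β` and `dB`. -/
theorem Surf.fires {f s u v c : VTerm} (hs : Surf f s u) (h : Fires f v c) :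
    ∃ c', Fires s v c' ∧ EquivO c (VTerm.jump c' u) := by
  have key : ∀ {a s' : VTerm}, Surf a s' (shift 1 u) →
      (0 ∈ s'.fv ↔ 0 ∈ a.fv) ∧ EquivO (inst a v) (VTerm.jump (inst s' v) u) := by
    intro a s' h
    constructor
    · rw [h.equiv.fv_eq]
      exact ⟨Or.inl, fun h => h.resolve_right (zero_notMem_fv_shift_one u)⟩
    · have := h.equiv.inst (.refl v)
      simp only [inst, subst] at this ⊢
      rwa [← inst, ← inst, ← inst, inst_shift_one] at this
  induction h generalizing s with
  | beta v h0 =>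
    obtain ⟨s', rfl, hs'⟩ := surf_lam_cases hs
    exact ⟨_, .beta v ((key hs').1.2 h0), (key hs').2⟩
  | dB v h0 =>
    obtain ⟨s', rfl, hs'⟩ := surf_lam_cases hs
    exact ⟨_, .dB v (mt (key hs').1.1 h0), ((key hs').2.jump (.refl v)).trans (.cs _ _ _)⟩
  | jump a h ih =>
    obtain ⟨rfl, rfl⟩ | ⟨s', rfl, hs'⟩ := surf_jump_cases hs
    · exact ⟨_, h, .refl _⟩
    · obtain ⟨c', hc, he⟩ := ih hs' key
      exact ⟨_, .jump a hc, (he.jump (.refl a)).trans (.cs _ _ _)⟩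

/-- A surface jump creates no redex and blocks none, since redexes act at a distance. Jumps unboxed
from elsewhere reach the surface beside it and commute with it. -/
theorem Surf.red {t t' s u : VTerm} (h : Surf t s u) (hr : Red t t') :
    (∃ s', StepO s s' ∧ EquivO t' (VTerm.jump s' u)) ∨
      ∃ L, JumpRed u L ∧ EquivO t' (jumps s L) := by
  induction h generalizing t' with
  | here s u =>
    obtain ⟨s', h, he⟩ | ⟨L, h, rfl⟩ := red_jump_cases hr
    · exact .inl ⟨s', .of_red h, he⟩
    · exact .inr ⟨L, h, .refl _⟩
  | lam _ ih =>
    obtain ⟨t1, h, he⟩ := red_lam_cases hr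
    obtain ⟨s', hs, he'⟩ | ⟨L, hL, he'⟩ := ih h
    · exact .inl ⟨_, hs.lam, he.trans (he'.lam.trans (.lamOut _ _))⟩
    · obtain ⟨L', rfl, hL'⟩ := hL.of_shift_one
      exact .inr ⟨L', hL', he.trans (he'.lam.trans (.lam_jumps _ _))⟩
  | @app t s u v hs ih =>
    obtain h | ⟨t1, h, he⟩ | ⟨v1, h, rfl⟩ | ⟨v1, w, h, rfl⟩ := red_app_cases hr
    · obtain ⟨c', hc, he⟩ := hs.fires h
      exact .inl ⟨c', .of_red (.fire hc), he⟩
    · obtain ⟨s', hs, he'⟩ | ⟨L, hL, he'⟩ := ih h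
      · exact .inl ⟨_, hs.appL v, he.trans ((he'.app (.refl v)).trans (.appOut _ _ _))⟩
      · exact .inr ⟨L, hL, he.trans ((he'.app (.refl v)).trans (.app_jumps _ _ _))⟩
    · exact .inl ⟨_, .of_red (.appR s h), (hs.equiv.app (.refl v1)).trans (.appOut _ _ _)⟩
    · refine .inl ⟨_, .of_red (.unbox (.appR s h)), ?_⟩
      exact (((hs.equiv.app (.refl v1)).trans (.appOut _ _ _)).jump (.refl w)).trans (.cs _ _ _)
  | @jump t s u v hs ih =>
    obtain ⟨t1, h, he⟩ | ⟨L, h, rfl⟩ := red_jump_cases hr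
    · obtain ⟨s', hs, he'⟩ | ⟨L, hL, he'⟩ := ih h
      · exact .inl ⟨_, hs.jumpL v, he.trans ((he'.jump (.refl v)).trans (.cs _ _ _))⟩
      · exact .inr ⟨L, hL, he.trans ((he'.jump (.refl v)).trans (.jump_jumps _ _ _))⟩
    · refine .inl ⟨_, .of_red (h.red_jumps s), ?_⟩
      exact (hs.equiv.jumps L).trans (EquivO.jump_jumps _ _ _).symm

/-! ### Strong normalisation of a term with a jump -/

/-- Strong normalisation for `StepO`, as accessibility. -/
def StepAcc (t : VTerm) : Prop := Acc (Function.swap StepO) t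

theorem SN_iff_acc {A : Type*} {R : A → A → Prop} {s : A} : SN R s ↔ Acc (Function.swap R) s := by
  rw [acc_iff_isEmpty_descending_chain, isEmpty_subtype, SN, not_exists]

theorem SN_iff_stepAcc {t : VTerm} : SN StepO t ↔ StepAcc t := SN_iff_acc

namespace StepAcc

theorem equiv {t u : VTerm} (h : StepAcc t) (he : EquivO t u) : StepAcc u :=
  Acc.intro _ fun _ hy => h.inv (StepO.equiv_left he hy)

theorem step {t u : VTerm} (h : StepAcc t) (h' : StepO t u) : StepAcc u := h.inv h'

theorem of_map {f : VTerm → VTerm} (hf : ∀ {a b}, StepO a b → StepO (f a) (f b)) {t : VTerm}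
    (h : StepAcc (f t)) : StepAcc t :=
  Subrelation.accessible (fun h => hf h) (InvImage.accessible f h)

end StepAcc

/-- The order on arguments of jumps: reduction and free strict subterms, modulo `EquivO`. -/
def ArgLt (v u : VTerm) : Prop := StepO u v ∨ ∃ u', EquivO u u' ∧ FreeSub v u'

theorem JumpRed.argLt {u v : VTerm} {L : List VTerm} (h : JumpRed u L) (hv : v ∈ L) :
    ArgLt v u := by
  cases h with
  | sub h => exact .inr ⟨u, .refl u, h v hv⟩
  | red h =>
    obtain rfl := List.mem_singleton.1 hv
    exact .inl (.of_red h)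
  | unbox h =>
    simp only [List.mem_cons, List.not_mem_nil, or_false] at hv
    obtain rfl | rfl := hv
    · exact .inl (.of_red h.red)
    · exact .inr ⟨u, .refl u, h.freeSub⟩

theorem ArgLt.equiv_right {v u u' : VTerm} (h : ArgLt v u) (he : EquivO u' u) : ArgLt v u' :=
  h.imp (StepO.equiv_left he) fun ⟨a, h1, h2⟩ => ⟨a, he.trans h1, h2⟩

theorem Occurs.equiv {v v' u : VTerm} (h : Occurs v u) (he : EquivO v v') :
    ∃ u', EquivO u u' ∧ Occurs v' u' := by
  induction h generalizing v' with
  | refl v => exact ⟨v', he, .refl v'⟩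
  | lam _ ih => obtain ⟨u', h1, h2⟩ := ih (he.shift 1); exact ⟨_, h1.lam, h2.lam⟩
  | appL u _ ih => obtain ⟨u', h1, h2⟩ := ih he; exact ⟨_, h1.app (.refl u), h2.appL u⟩
  | appR t _ ih => obtain ⟨u', h1, h2⟩ := ih he; exact ⟨_, (EquivO.refl t).app h1, h2.appR t⟩
  | jumpL u _ ih => obtain ⟨u', h1, h2⟩ := ih he; exact ⟨_, h1.jump (.refl u), h2.jumpL u⟩
  | jumpR t _ ih => obtain ⟨u', h1, h2⟩ := ih he; exact ⟨_, (EquivO.refl t).jump h1, h2.jumpR t⟩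

theorem Occurs.step {v v' u : VTerm} (h : Occurs v u) (he : StepO v v') :
    ∃ u', StepO u u' ∧ Occurs v' u' := by
  induction h generalizing v' with
  | refl v => exact ⟨v', he, .refl v'⟩
  | lam _ ih => obtain ⟨u', h1, h2⟩ := ih (he.shift 1); exact ⟨_, h1.lam, h2.lam⟩
  | appL u _ ih => obtain ⟨u', h1, h2⟩ := ih he; exact ⟨_, h1.appL u, h2.appL u⟩
  | appR t _ ih => obtain ⟨u', h1, h2⟩ := ih he; exact ⟨_, h1.appR t, h2.appR t⟩
  | jumpL u _ ih => obtain ⟨u', h1, h2⟩ := ih he; exact ⟨_, h1.jumpL u, h2.jumpL u⟩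
  | jumpR t _ ih => obtain ⟨u', h1, h2⟩ := ih he; exact ⟨_, h1.jumpR t, h2.jumpR t⟩

/-- A step inside a free subterm is a step of the whole term, while passing to a strict subterm
lowers the size, which the equivalence preserves. Hence a lexicographic induction on the ambient
term and then on the size of the subterm. -/
theorem StepAcc.acc_argLt {u : VTerm} (hu : StepAcc u) : Acc ArgLt u := by
  have key : ∀ u u' v, StepAcc u → EquivO u u' → Occurs v u' → Acc ArgLt v := by
    intro u u' v hu
    induction hu generalizing u' v with
    | intro u _ ih =>
      induction hn : v.size using Nat.strong_induction_on generalizing u' v with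
      | _ n ihn =>
        intro he hv
        refine Acc.intro v fun v1 hv1 => ?_
        obtain h | ⟨v2, h, h'⟩ := hv1
        · obtain ⟨u1, hu1, ho⟩ := hv.step h
          exact ih u1 (.equiv_left he hu1) u1 v1 (.refl _) ho
        · obtain ⟨u2, hu2, ho⟩ := hv.equiv h
          refine ihn v1.size ?_ u2 v1 rfl (he.trans hu2) (h'.occurs.trans ho)
          rw [← hn, h.size_eq]
          exact h'.size_lt
  exact key u u u hu (.refl u) (.refl u)

theorem StepAcc.jumps {s : VTerm} {L : List VTerm} (hs : StepAcc s)
    (hL : ∀ v ∈ L, ∀ s, StepAcc s → StepAcc (jump s v)) : StepAcc (jumps s L) := by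
  induction L generalizing s with
  | nil => exact hs
  | cons v L ih =>
    exact ih (hL v (by simp) s hs) fun w hw => hL w (List.mem_cons_of_mem v hw)

/-- The induction on `u` is the outer one and is uniform in `s`: when `[_/u]` splits into several
smaller jumps, they are added one at a time to a term that already carries the previous ones. -/
theorem StepAcc.jump {s u : VTerm} (hs : StepAcc s) (hu : StepAcc u) :
    StepAcc (VTerm.jump s u) := by
  replace hu := hu.acc_argLt
  induction hu generalizing s with
  | intro u _ ihu =>
    induction hs with
    | intro s hs ihs =>
      refine Acc.intro _ fun t' ht' => ?_
      obtain ⟨t1, t2, h1, h2, h3⟩ := StepO.exists_red ht'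
      refine StepAcc.equiv ?_ h3
      obtain ⟨s1, u1, hsurf, hs1, hu1⟩ := Surf.of_equiv h1
      obtain ⟨s', hs', he⟩ | ⟨L, hL, he⟩ := hsurf.red h2
      · exact (ihs s' (.equiv_left hs1 hs')).equiv (((EquivO.refl s').jump hu1).trans he.symm)
      · refine StepAcc.equiv ?_ he.symm
        have hlt : ∀ v ∈ L, ArgLt v u := fun v hv => (hL.argLt hv).equiv_right hu1
        exact StepAcc.jumps (StepAcc.equiv (Acc.intro s hs) hs1) fun v hv _ h => ihu v (hlt v hv) h

/-! ### The trunk -/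

theorem extend_setOf_lt (k : ℕ) : extend {n | n < k} = {n | n < k + 1} := by
  ext n
  cases n <;> simp [extend]

/-- A term is its trunk, with its surface jumps around it. -/
theorem SurfaceSN.exists_jumps {t : VTerm} {k : ℕ} (h : SurfaceSN {n | n < k} t) :
    ∃ L : List VTerm, (∀ v ∈ L, StepAcc v) ∧
      EquivO t (jumps (trunk {n | n < k} t) (L.map (shift k))) := by
  induction t generalizing k with
  | var n => exact ⟨[], by simp, .refl _⟩
  | lam t ih =>
    simp only [SurfaceSN, trunk, extend_setOf_lt] at h ⊢
    obtain ⟨L, hL, he⟩ := ih h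
    refine ⟨L, hL, he.lam.trans ?_⟩
    have : L.map (shift (k + 1)) = (L.map (shift k)).map (shift 1) := by
      simp only [List.map_map, Function.comp_def, shift_shift]
    rw [this]
    exact .lam_jumps _ _
  | app t u iht _ =>
    obtain ⟨L, hL, he⟩ := iht h
    exact ⟨L, hL, (he.app (.refl u)).trans (.app_jumps _ _ _)⟩
  | jump t u iht _ =>
    obtain ⟨L, hL, he⟩ := iht h.1
    by_cases hu : u.fv ∩ {n | n < k} = ∅
    -- Under `k` binders, starting from no variables, the set `Γ` is the first `k` indices; avoiding
    -- it means being a shift by `k`, so the jump can leave all `k` binders.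
    · obtain ⟨v, rfl⟩ : ∃ v, shift k v = u := exists_shift_eq fun n hn =>
        not_lt.1 fun hlt => (Set.ext_iff.1 hu n).1 ⟨hn, hlt⟩
      have hv : StepAcc v := StepAcc.of_map (.shift k) (SN_iff_stepAcc.1 (h.2 hu))
      refine ⟨L ++ [v], ?_, ?_⟩
      · simpa [or_imp, forall_and] using ⟨hL, hv⟩
      · have := he.jump (.refl (shift k v))
        simpa [trunk, hu, jumps] using this
    · refine ⟨L, hL, (he.jump (.refl u)).trans ?_⟩
      rw [trunk, if_neg hu]
      exact .jump_jumps _ _ _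

theorem stepAcc_of_trunk {t : VTerm} (h : StepAcc (trunk ∅ t)) (hs : SurfaceSN ∅ t) :
    StepAcc t := by
  have h0 : (∅ : Set ℕ) = {n | n < 0} := by simp
  rw [h0] at h hs
  obtain ⟨L, hL, he⟩ := hs.exists_jumps
  refine StepAcc.equiv (h.jumps fun v hv s hs => hs.jump ?_) he.symm
  obtain ⟨w, hw, rfl⟩ := List.mem_map.1 hv
  rw [shift_zero]
  exact hL w hw

/-! ### Simulations for abstractions, variable heads and head redexes -/

/-- Strong normalisation is inherited along a simulation. -/
theorem StepAcc.of_simulation {R : VTerm → VTerm → Prop}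
    (hE : ∀ {t c t'}, R t c → EqStep t t' → ∃ c', R t' c' ∧ EquivO c c')
    (hS : ∀ {t c t'}, R t c → Red t t' → EquivO c t' ∨ StepO c t' ∨
      ∃ t'' c', EquivO t' t'' ∧ R t'' c' ∧ TransGen StepO c c')
    {t c : VTerm} (hc : StepAcc c) (h : R t c) : StepAcc t := by
  -- One step of `t` may cost several steps of `c`, so the induction runs on the transitive closure.
  have hacc := hc.transGen
  induction hacc generalizing t with
  | intro c _ ih =>
    refine Acc.intro t fun t' ht' => ?_
    obtain ⟨t1, t2, h1, h2, h3⟩ := StepO.exists_red ht'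
    refine StepAcc.equiv ?_ h3
    obtain ⟨c1, hR, hc1⟩ : ∃ c1, R t1 c1 ∧ EquivO c c1 := by
      replace h1 := h1.reflTransGen
      clear h2
      induction h1 with
      | refl => exact ⟨c, h, .refl c⟩
      | tail _ h ih =>
        obtain ⟨c1, hR, hc1⟩ := ih
        obtain ⟨c2, hR', hc2⟩ := hE hR h
        exact ⟨c2, hR', hc1.trans hc2⟩
    obtain he | hs | ⟨t'', c', he, hR', hs⟩ := hS hR h2
    · exact hc.equiv (hc1.trans he)
    · exact hc.step (.equiv_left hc1 hs)
    · have hs' : TransGen StepO c c' := by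
        obtain ⟨d, hd, hd'⟩ := TransGen.head'_iff.1 hs
        exact TransGen.head' (.equiv_left hc1 hd) hd'
      refine StepAcc.equiv (ih c' (transGen_swap.2 hs') ?_ hR') he.symm
      exact hc.inv_of_transGen (transGen_swap.2 hs')

/-- `t` is `λ.s`, up to the position of surface jumps. -/
inductive UnderLam : VTerm → VTerm → Prop
  | lam (s) : UnderLam (lam s) s
  | jump {t s} (u) : UnderLam t s → UnderLam (jump t u) (jump s (shift 1 u))

theorem UnderLam.jumps {t s : VTerm} (h : UnderLam t s) (L : List VTerm) :
    UnderLam (jumps t L) (jumps s (L.map (shift 1))) := by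
  induction L generalizing t s with
  | nil => exact h
  | cons u L ih => exact ih (h.jump u)

theorem UnderLam.eqStep {t s t' : VTerm} (h : UnderLam t s) (he : EqStep t t') :
    ∃ s', UnderLam t' s' ∧ EquivO s s' := by
  induction h generalizing t' with
  | lam s =>
    cases he with
    | lamOut t a => exact ⟨_, .jump a (.lam t), .refl _⟩
    | lam h => exact ⟨_, .lam _, .of_eqStep h⟩
  | jump u h ih =>
    cases he with
    | cs t a _ =>
      cases h with
      | jump _ h => exact ⟨_, .jump a (.jump u h), .cs _ _ _⟩
    | lamIn t _ =>
      cases h with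
      | lam _ => exact ⟨_, .lam _, .refl _⟩
    | appIn t _ v => cases h
    | jumpL _ he =>
      obtain ⟨s', h, hs⟩ := ih he
      exact ⟨_, .jump u h, hs.jump (.refl _)⟩
    | jumpR _ he => exact ⟨_, .jump _ h, (EquivO.refl _).jump (.shift 1 (.of_eqStep he))⟩

/-- With its surface jumps pushed back under the binder, an abstraction has no root redex of its
own: each step is one of the body. -/
theorem UnderLam.red {t s t' : VTerm} (h : UnderLam t s) (hr : Red t t') :
    ∃ t'' s', EquivO t' t'' ∧ UnderLam t'' s' ∧ StepO s s' := by
  induction h generalizing t' with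
  | lam s =>
    obtain ⟨s', h, he⟩ := red_lam_cases hr
    exact ⟨_, s', he, .lam s', .of_red h⟩
  | @jump t s u h ih =>
    obtain ⟨t1, hr, he⟩ | ⟨L, hL, rfl⟩ := red_jump_cases hr
    · obtain ⟨t'', s', he', h', hs⟩ := ih hr
      exact ⟨_, _, he.trans (he'.jump (.refl u)), .jump u h', hs.jumpL _⟩
    · exact ⟨_, _, .refl _, h.jumps L, .of_red (hL.shift_one.red_jumps s)⟩

theorem StepAcc.lam {t : VTerm} (h : StepAcc t) : StepAcc (lam t) :=
  StepAcc.of_simulation (R := UnderLam) UnderLam.eqStep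
    (fun h hr => let ⟨t'', s', h1, h2, h3⟩ := h.red hr; .inr (.inr ⟨t'', s', h1, h2, .single h3⟩))
    h (.lam t)

/-- `t` is a variable applied to arguments, up to surface jumps, and `c` is obtained from `t` by
turning the arguments into jumps. -/
inductive VarSpine : VTerm → VTerm → Prop
  | var (n) : VarSpine (var n) (var n)
  | app {t c} (v) : VarSpine t c → VarSpine (app t v) (jump c v)
  | jump {t c} (u) : VarSpine t c → VarSpine (jump t u) (jump c u)

theorem VarSpine.jumps {t c : VTerm} (h : VarSpine t c) (L : List VTerm) :
    VarSpine (jumps t L) (jumps c L) := by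
  induction L generalizing t c with
  | nil => exact h
  | cons u L ih => exact ih (h.jump u)

theorem VarSpine.eqStep {t c t' : VTerm} (h : VarSpine t c) (he : EqStep t t') :
    ∃ c', VarSpine t' c' ∧ EquivO c c' := by
  induction h generalizing t' with
  | var n => cases he
  | app v h ih =>
    cases he with
    | appOut t a _ =>
      cases h with
      | jump _ h => exact ⟨_, .jump a (.app v h), .cs _ _ _⟩
    | appL _ he =>
      obtain ⟨c', h, hc⟩ := ih he
      exact ⟨_, .app v h, hc.jump (.refl v)⟩
    | appR _ he => exact ⟨_, .app _ h, (EquivO.refl _).jump (.of_eqStep he)⟩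
  | jump u h ih =>
    cases he with
    | cs t a _ =>
      cases h with
      | jump _ h => exact ⟨_, .jump a (.jump u h), .cs _ _ _⟩
    | lamIn t _ => cases h
    | appIn t _ v =>
      cases h with
      | app _ h => exact ⟨_, .app v (.jump u h), .cs _ _ _⟩
    | jumpL _ he =>
      obtain ⟨c', h, hc⟩ := ih he
      exact ⟨_, .jump u h, hc.jump (.refl u)⟩
    | jumpR _ he => exact ⟨_, .jump _ h, (EquivO.refl _).jump (.of_eqStep he)⟩

/-- The head is a variable and stays one, so the arguments evolve independently, as jumps do. -/
theorem VarSpine.not_fires {t c u r : VTerm} (h : VarSpine t c) : ¬ Fires t u r := by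
  induction h generalizing r with
  | var n => nofun
  | app v h ih => nofun
  | jump a h ih => exact fun hf => by cases hf with | jump _ hf => exact ih hf

theorem VarSpine.red {t c t' : VTerm} (h : VarSpine t c) (hr : Red t t') :
    ∃ t'' c', EquivO t' t'' ∧ VarSpine t'' c' ∧ StepO c c' := by
  induction h generalizing t' with
  | var n => cases hr with | unbox h => cases h
  | @app t c v h ih =>
    obtain hf | ⟨t1, hr, he⟩ | ⟨v1, hv1, rfl⟩ | ⟨v1, w, hx, rfl⟩ := red_app_cases hr
    · exact absurd hf h.not_fires
    · obtain ⟨t'', c', he', h', hc⟩ := ih hr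
      exact ⟨_, _, he.trans (he'.app (.refl v)), .app v h', hc.jumpL v⟩
    · exact ⟨_, _, .refl _, .app v1 h, .of_red (.jumpR c hv1)⟩
    · exact ⟨_, _, .refl _, .jump w (.app v1 h), .of_red (.unbox (.jumpR c hx))⟩
  | @jump t c u h ih =>
    obtain ⟨t1, hr, he⟩ | ⟨L, hL, rfl⟩ := red_jump_cases hr
    · obtain ⟨t'', c', he', h', hc⟩ := ih hr
      exact ⟨_, _, he.trans (he'.jump (.refl u)), .jump u h', hc.jumpL u⟩
    · exact ⟨_, _, .refl _, h.jumps L, .of_red (hL.red_jumps c)⟩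

theorem VarSpine.stepAcc {t c : VTerm} (h : VarSpine t c) (hc : StepAcc c) : StepAcc t :=
  StepAcc.of_simulation (R := VarSpine) VarSpine.eqStep
    (fun h hr => let ⟨t'', s', h1, h2, h3⟩ := h.red hr; .inr (.inr ⟨t'', s', h1, h2, .single h3⟩))
    hc h

/-- `f = (λ.a)L` and `c = a{0/u}[_/u]L`. -/
inductive LamSpine : VTerm → VTerm → VTerm → Prop
  | lam (a u) : LamSpine (lam a) u (jump (inst a u) u)
  | jump {f u c} (s) : LamSpine f u c → LamSpine (jump f s) u (jump c s)

/-- `t` has a head redex `(λ.a)L u`, and `c` is `t` with `a{0/u}[_/u]L` in its place. -/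
inductive HeadRedex : VTerm → VTerm → Prop
  | redex {f u c} : LamSpine f u c → HeadRedex (app f u) c
  | app {t c} (v) : HeadRedex t c → HeadRedex (app t v) (app c v)
  | jump {t c} (u) : HeadRedex t c → HeadRedex (jump t u) (jump c u)

theorem LamSpine.jumps {f u c : VTerm} (h : LamSpine f u c) (L : List VTerm) :
    LamSpine (jumps f L) u (jumps c L) := by
  induction L generalizing f c with
  | nil => exact h
  | cons s L ih => exact ih (h.jump s)

theorem HeadRedex.jumps {t c : VTerm} (h : HeadRedex t c) (L : List VTerm) :
    HeadRedex (jumps t L) (jumps c L) := by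
  induction L generalizing t c with
  | nil => exact h
  | cons u L ih => exact ih (h.jump u)

theorem LamSpine.eqStep {f f' u c : VTerm} (h : LamSpine f u c) (he : EqStep f f') :
    ∃ c', LamSpine f' u c' ∧ EquivO c c' := by
  induction h generalizing f' with
  | lam a u =>
    cases he with
    | lamOut t s =>
      refine ⟨_, .jump s (.lam t u), ?_⟩
      rw [inst, subst, ← inst, ← inst, inst_shift_one]
      exact .cs _ _ _
    | lam he => exact ⟨_, .lam _ u, ((EquivO.of_eqStep he).inst (.refl u)).jump (.refl u)⟩
  | @jump f u c s h ih =>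
    cases he with
    | cs t a _ =>
      cases h with
      | jump _ h => exact ⟨_, .jump a (.jump s h), .cs _ _ _⟩
    | lamIn t _ =>
      cases h with
      | lam _ _ =>
        refine ⟨_, .lam _ u, ?_⟩
        rw [inst, inst, subst, ← inst, ← inst, inst_shift_one]
        exact .cs _ _ _
    | appIn t _ v => cases h
    | jumpL _ he =>
      obtain ⟨c', h, hc⟩ := ih he
      exact ⟨_, .jump s h, hc.jump (.refl s)⟩
    | jumpR _ he => exact ⟨_, .jump _ h, (EquivO.refl c).jump (.of_eqStep he)⟩

theorem LamSpine.equiv_arg {f u u' c : VTerm} (h : LamSpine f u c) (he : EquivO u u') :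
    ∃ c', LamSpine f u' c' ∧ EquivO c c' := by
  induction h with
  | lam a u => exact ⟨_, .lam a u', ((EquivO.refl a).inst he).jump he⟩
  | jump s h ih =>
    obtain ⟨c', h, hc⟩ := ih he
    exact ⟨_, .jump s h, hc.jump (.refl s)⟩

/-- For `dB` the term `c` is the contractum itself; for `β` it has the extra jump `[_/u]`, which the
rule `h` erases. -/
theorem LamSpine.fires {f u c r : VTerm} (h : LamSpine f u c) (hf : Fires f u r) :
    EquivO c r ∨ StepO c r := by
  induction h generalizing r with
  | lam a u =>
    cases hf with
    | beta _ _ => exact .inr (.of_red (Red.h (L := []) _ (by simp)))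
    | dB _ _ => exact .inl (.refl _)
  | jump s h ih =>
    cases hf with
    | jump _ hf => exact (ih hf).imp (fun h => h.jump (.refl s)) (StepO.jumpL s)

theorem LamSpine.red {f f' u c : VTerm} (h : LamSpine f u c) (hr : Red f f') :
    ∃ f'' c', EquivO f' f'' ∧ LamSpine f'' u c' ∧ StepO c c' := by
  induction h generalizing f' with
  | lam a u =>
    obtain ⟨a', h, he⟩ := red_lam_cases hr
    exact ⟨_, _, he, .lam a' u, .of_red (.jumpL u (h.subst _))⟩
  | @jump f u c s h ih =>
    obtain ⟨t1, hr, he⟩ | ⟨L, hL, rfl⟩ := red_jump_cases hr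
    · obtain ⟨t'', c', he', h', hc⟩ := ih hr
      exact ⟨_, _, he.trans (he'.jump (.refl s)), .jump s h', hc.jumpL s⟩
    · exact ⟨_, _, .refl _, h.jumps L, .of_red (hL.red_jumps c)⟩

theorem LamSpine.red_arg {f u u' c : VTerm} (h : LamSpine f u c) (hr : Red u u') :
    ∃ c', LamSpine f u' c' ∧ TransGen StepO c c' := by
  induction h with
  | lam a u =>
    -- The copy of `u` in the jump makes the simulation strict even if the bound variable does not
    -- occur in `a`.
    refine ⟨_, .lam a u', TransGen.head' (StepO.of_red (.jumpR _ hr)) ?_⟩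
    exact ReflTransGen.lift (VTerm.jump · u') (fun _ _ => StepO.jumpL u') _ _
      (StepO.reflTransGen_inst a (.of_red hr))
  | jump s h ih =>
    obtain ⟨c', h, hc⟩ := ih hr
    exact ⟨_, .jump s h, TransGen.lift (VTerm.jump · s) (fun _ _ => StepO.jumpL s) _ _ hc⟩

theorem LamSpine.extracts_arg {f u u' w c : VTerm} (h : LamSpine f u c) (hx : Extracts u u' w) :
    ∃ c', LamSpine f u' c' ∧ TransGen StepO c (VTerm.jump c' w) := by
  induction h with
  | lam a u =>
    -- Only the copy in the jump releases `w`; in the copies substituted into `a` the jump on `w` is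
    -- erased, so a single `[_/w]` remains.
    refine ⟨_, .lam a u', TransGen.head' (StepO.of_red (.unbox (.jumpR _ hx))) ?_⟩
    exact ReflTransGen.lift (fun t => VTerm.jump (VTerm.jump t u') w)
      (fun _ _ h => StepO.jumpL w (StepO.jumpL u' h)) _ _
      (StepO.reflTransGen_inst a (.of_red hx.red))
  | @jump f u c s h ih =>
    obtain ⟨c', h, hc⟩ := ih hx
    refine ⟨_, .jump s h, ?_⟩
    have := TransGen.lift (VTerm.jump · s) (fun _ _ => StepO.jumpL s) _ _ hc
    obtain ⟨d, hd, hd'⟩ := TransGen.tail'_iff.1 this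
    exact TransGen.tail' hd (hd'.equiv_right (.cs _ _ _))

theorem HeadRedex.eqStep {t c t' : VTerm} (h : HeadRedex t c) (he : EqStep t t') :
    ∃ c', HeadRedex t' c' ∧ EquivO c c' := by
  induction h generalizing t' with
  | @redex f u c h =>
    cases he with
    | appOut t s _ =>
      cases h with
      | jump _ h => exact ⟨_, .jump s (.redex h), .refl _⟩
    | appL _ he =>
      obtain ⟨c', h, hc⟩ := h.eqStep he
      exact ⟨c', .redex h, hc⟩
    | appR _ he =>
      obtain ⟨c', h, hc⟩ := h.equiv_arg (.of_eqStep he)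
      exact ⟨c', .redex h, hc⟩
  | app v h ih =>
    cases he with
    | appOut t s _ =>
      cases h with
      | jump _ h => exact ⟨_, .jump s (.app v h), .appOut _ _ _⟩
    | appL _ he =>
      obtain ⟨c', h, hc⟩ := ih he
      exact ⟨_, .app v h, hc.app (.refl v)⟩
    | appR _ he => exact ⟨_, .app _ h, (EquivO.refl _).app (.of_eqStep he)⟩
  | jump u h ih =>
    cases he with
    | cs t s _ =>
      cases h with
      | jump _ h => exact ⟨_, .jump s (.jump u h), .cs _ _ _⟩
    | lamIn t _ => cases h
    | appIn t _ v =>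
      cases h with
      | redex h => exact ⟨_, .redex (.jump u h), .refl _⟩
      | app _ h => exact ⟨_, .app v (.jump u h), (EquivO.appOut _ _ _).symm⟩
    | jumpL _ he =>
      obtain ⟨c', h, hc⟩ := ih he
      exact ⟨_, .jump u h, hc.jump (.refl u)⟩
    | jumpR _ he => exact ⟨_, .jump _ h, (EquivO.refl _).jump (.of_eqStep he)⟩

theorem HeadRedex.not_fires {t c u r : VTerm} (h : HeadRedex t c) : ¬ Fires t u r := by
  induction h generalizing r with
  | redex h => nofun
  | app v h ih => nofun
  | jump a h ih => exact fun hf => by cases hf with | jump _ hf => exact ih hf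

/-- The first two outcomes occur when the head redex fires, after which `c` itself accounts for the
result; any other step keeps the head redex and is matched strictly. -/
theorem HeadRedex.red {t c t' : VTerm} (h : HeadRedex t c) (hr : Red t t') :
    EquivO c t' ∨ StepO c t' ∨
      ∃ t'' c', EquivO t' t'' ∧ HeadRedex t'' c' ∧ TransGen StepO c c' := by
  induction h generalizing t' with
  | @redex f u c h =>
    obtain hf | ⟨t1, hr, he⟩ | ⟨v1, hv1, rfl⟩ | ⟨v1, w, hx, rfl⟩ := red_app_cases hr
    · exact (h.fires hf).imp id .inl
    · obtain ⟨f'', c', he', h', hc⟩ := h.red hr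
      exact .inr (.inr ⟨_, c', he.trans (he'.app (.refl u)), .redex h', .single hc⟩)
    · obtain ⟨c', h', hc⟩ := h.red_arg hv1
      exact .inr (.inr ⟨_, c', .refl _, .redex h', hc⟩)
    · obtain ⟨c', h', hc⟩ := h.extracts_arg hx
      exact .inr (.inr ⟨_, _, .refl _, .jump w (.redex h'), hc⟩)
  | @app t c v h ih =>
    obtain hf | ⟨t1, hr, he⟩ | ⟨v1, hv1, rfl⟩ | ⟨v1, w, hx, rfl⟩ := red_app_cases hr
    · exact absurd hf h.not_fires
    · obtain he' | hs | ⟨t'', c', he', h', hc⟩ := ih hr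
      · exact .inl ((he'.app (.refl v)).trans he.symm)
      · exact .inr (.inl ((hs.appL v).equiv_right he.symm))
      · exact .inr (.inr ⟨_, _, he.trans (he'.app (.refl v)), .app v h',
          TransGen.lift (VTerm.app · v) (fun _ _ => StepO.appL v) _ _ hc⟩)
    · exact .inr (.inr ⟨_, _, .refl _, .app v1 h, .single (.of_red (.appR c hv1))⟩)
    · exact .inr (.inr ⟨_, _, .refl _, .jump w (.app v1 h),
        .single (.of_red (.unbox (.appR c hx)))⟩)
  | @jump t c u h ih =>
    obtain ⟨t1, hr, he⟩ | ⟨L, hL, rfl⟩ := red_jump_cases hr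
    · obtain he' | hs | ⟨t'', c', he', h', hc⟩ := ih hr
      · exact .inl ((he'.jump (.refl u)).trans he.symm)
      · exact .inr (.inl ((hs.jumpL u).equiv_right he.symm))
      · exact .inr (.inr ⟨_, _, he.trans (he'.jump (.refl u)), .jump u h',
          TransGen.lift (VTerm.jump · u) (fun _ _ => StepO.jumpL u) _ _ hc⟩)
    · exact .inr (.inr ⟨_, _, .refl _, h.jumps L, .single (.of_red (hL.red_jumps c))⟩)

theorem HeadRedex.stepAcc {t c : VTerm} (h : HeadRedex t c) (hc : StepAcc c) : StepAcc t :=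
  StepAcc.of_simulation (R := HeadRedex) HeadRedex.eqStep HeadRedex.red hc h

theorem stepAcc_var (n : ℕ) : StepAcc (var n) := by
  refine Acc.intro _ fun t' ht' => ?_
  obtain ⟨t1, t2, h1, h2, -⟩ := StepO.exists_red ht'
  obtain rfl : t1 = var n := by
    replace h1 := h1.reflTransGen
    clear h2
    induction h1 with
    | refl => rfl
    | tail _ h ih => subst ih; cases h
  cases h2 with
  | unbox h => cases h

/-! ### Preservation of strong normalisation for `λ`-terms -/

/-- `v` is an immediate subterm of the `λ`-term `t`. -/
inductive ImmSub : VTerm → VTerm → Prop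
  | lam (t) : ImmSub t (lam t)
  | appL (t u) : ImmSub t (app t u)
  | appR (t u) : ImmSub u (app t u)

theorem ImmSub.size_lt {v t : VTerm} (h : ImmSub v t) : v.size < t.size := by
  cases h <;> simp only [size] <;> omega

theorem ImmSub.isLambda {v t : VTerm} (h : ImmSub v t) (ht : t.IsLambda) : v.IsLambda := by
  cases h with
  | lam _ => exact ht
  | appL _ _ => exact ht.1
  | appR _ _ => exact ht.2

theorem ImmSub.lambdaBeta {v v' t : VTerm} (h : ImmSub v t) (hb : LambdaBeta v v') :
    ∃ t', LambdaBeta t t' ∧ ImmSub v' t' := by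
  cases h with
  | lam _ => exact ⟨_, CtxClosure.lam hb, .lam _⟩
  | appL _ u => exact ⟨_, CtxClosure.appL u hb, .appL _ u⟩
  | appR t _ => exact ⟨_, CtxClosure.appR t hb, .appR t _⟩

theorem exists_lambdaBeta_of_subterm {v v' t : VTerm} (h : ReflTransGen ImmSub v t)
    (hb : LambdaBeta v v') : ∃ t', LambdaBeta t t' ∧ ReflTransGen ImmSub v' t' := by
  induction h with
  | refl => exact ⟨v', hb, .refl⟩
  | tail _ hs ih =>
    obtain ⟨a, ha, hs'⟩ := ih
    obtain ⟨b, hb, hs''⟩ := hs.lambdaBeta ha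
    exact ⟨b, hb, hs'.tail hs''⟩

/-- `β`-reduction and immediate subterms together. -/
def BetaSub (v t : VTerm) : Prop := LambdaBeta t v ∨ ImmSub v t

/-- As for `StepAcc.acc_argLt`: `β`-steps of a subterm lift to the ambient term, and taking subterms
decreases the size. -/
theorem acc_betaSub {t : VTerm} (h : Acc (Function.swap LambdaBeta) t) : Acc BetaSub t := by
  have key : ∀ v, ReflTransGen ImmSub v t → Acc BetaSub v := by
    induction h with
    | intro t _ ih =>
      intro v
      induction hn : v.size using Nat.strong_induction_on generalizing v with
      | _ n ihn =>
        intro hv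
        refine Acc.intro v fun v1 hv1 => ?_
        obtain h | h := hv1
        · obtain ⟨t1, ht1, hs⟩ := exists_lambdaBeta_of_subterm hv h
          exact ih t1 ht1 v1 hs
        · exact ihn v1.size (hn ▸ h.size_lt) v1 rfl (.head h hv)
  exact key t .refl

theorem IsLambda.rename {t : VTerm} (h : t.IsLambda) (ξ : ℕ → ℕ) : (rename ξ t).IsLambda := by
  induction t generalizing ξ with
  | var n => trivial
  | lam t ih => exact ih h _
  | app t u iht ihu => exact ⟨iht h.1 ξ, ihu h.2 ξ⟩
  | jump t u _ _ => exact h.elim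

theorem IsLambda.subst {t : VTerm} (h : t.IsLambda) {σ : ℕ → VTerm}
    (hσ : ∀ n, (σ n).IsLambda) : (subst σ t).IsLambda := by
  induction t generalizing σ with
  | var n => exact hσ n
  | lam t ih =>
    refine ih h fun n => ?_
    cases n with
    | zero => trivial
    | succ n => exact IsLambda.rename (hσ n) _
  | app t u iht ihu => exact ⟨iht h.1 hσ, ihu h.2 hσ⟩
  | jump t u _ _ => exact h.elim

theorem IsLambda.inst {a u : VTerm} (ha : a.IsLambda) (hu : u.IsLambda) :
    (inst a u).IsLambda := by
  refine IsLambda.subst ha fun n => ?_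
  cases n with
  | zero => exact hu
  | succ n => trivial

theorem IsLambda.cases_head {t : VTerm} (h : t.IsLambda) :
    (∃ a, t = lam a) ∨ (∃ c, VarSpine t c) ∨ ∃ c, HeadRedex t c := by
  induction t with
  | var n => exact .inr (.inl ⟨_, .var n⟩)
  | lam a _ => exact .inl ⟨a, rfl⟩
  | app f v ih _ =>
    obtain ⟨a, rfl⟩ | ⟨c, hc⟩ | ⟨c, hc⟩ := ih h.1
    · exact .inr (.inr ⟨_, .redex (.lam a v)⟩)
    · exact .inr (.inl ⟨_, .app v hc⟩)
    · exact .inr (.inr ⟨_, .app v hc⟩)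
  | jump t u _ _ => exact h.elim

/-- For a `λ`-term, `c` is the head variable followed by one jump per argument, each argument being
a strict subterm; `StepAcc.jump` applies at each of them. -/
theorem VarSpine.stepAcc_jumps {t c : VTerm} (h : VarSpine t c) (ht : t.IsLambda)
    (hs : ∀ v, TransGen ImmSub v t → StepAcc v) : StepAcc c := by
  induction h with
  | var n => exact stepAcc_var n
  | app v h ih =>
    exact (ih ht.1 fun w hw => hs w (hw.tail (.appL _ v))).jump (hs v (.single (.appR _ v)))
  | jump u h _ => exact ht.elim

/-- Here `r` is the head `β`-reduct and `u` the argument of the head redex: its jump slides out of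
the remaining applications to the root. -/
theorem HeadRedex.exists_lambdaBeta {t c : VTerm} (h : HeadRedex t c) (ht : t.IsLambda) :
    ∃ r u, LambdaBeta t r ∧ r.IsLambda ∧ TransGen ImmSub u t ∧ u.IsLambda ∧
      EquivO (VTerm.jump r u) c := by
  induction h with
  | redex h =>
    cases h with
    | lam a =>
      rename_i u
      exact ⟨inst a u, u, .ofBase (.beta a u), IsLambda.inst ht.1 ht.2, .single (.appR _ u), ht.2,
        .refl _⟩
    | jump s h => exact ht.1.elim
  | app v h ih =>
    obtain ⟨r, u, h1, h2, h3, h4, h5⟩ := ih ht.1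
    exact ⟨VTerm.app r v, u, CtxClosure.appL v h1, ⟨h2, ht.2⟩, h3.tail (.appL _ v), h4,
      (EquivO.appOut r u v).symm.trans (h5.app (.refl v))⟩
  | jump u h _ => exact ht.elim

theorem stepAcc_of_lambdaBeta {t : VTerm} (ht : t.IsLambda)
    (h : Acc (Function.swap LambdaBeta) t) : StepAcc t := by
  -- The transitive closure is needed because arguments in a spine are subterms at arbitrary depth.
  have hacc := (acc_betaSub h).transGen
  clear h
  induction hacc with
  | intro t _ ih =>
    have hsub : ∀ v, TransGen ImmSub v t → StepAcc v := fun v hv =>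
      ih v (TransGen.mono (fun _ _ => Or.inr) _ _ hv) <| by
        induction hv using TransGen.head_induction_on with
        | single h => exact h.isLambda ht
        | head h _ ih => exact h.isLambda ih
    obtain ⟨a, rfl⟩ | ⟨c, hc⟩ | ⟨c, hc⟩ := IsLambda.cases_head ht
    · exact (hsub a (.single (.lam a))).lam
    · exact hc.stepAcc (hc.stepAcc_jumps ht hsub)
    · obtain ⟨r, u, hr, hr', hu, -, he⟩ := hc.exists_lambdaBeta ht
      exact hc.stepAcc (((ih r (.single (.inl hr)) hr').jump (hsub u hu)).equiv he)

end VoidJumps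

open VoidJumps in
theorem corollaryc :
    (∀ t : VTerm, SN StepO (trunk ∅ t) → SurfaceSN ∅ t → SN StepO t) ∧
    (∀ t : VTerm, t.IsLambda → SN LambdaBeta t → SN StepO t) :=
  ⟨fun _ h hs => SN_iff_stepAcc.2 (stepAcc_of_trunk (SN_iff_stepAcc.1 h) hs),
    fun _ ht h => SN_iff_stepAcc.2 (stepAcc_of_lambdaBeta ht (SN_iff_acc.1 h))⟩
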